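/- Let $N_t\ge 0$ and $l$ be integers with $l>\frac{N_t}{2}+2$, and let $\Omega_t=[0,1]^{N_t}\subset\mathbb{R}^{N_t}$. Let $H^l(\Omega_t)=W^{l,2}(\Omega_t)$ be the Sobolev space of real-valued functions on $\Omega_t$ (modulo equality almost everywhere) whose weak derivatives of all orders $\le l$ on the open cube $(0,1)^{N_t}$ belong to $L^2$. Let $\sigma(x)=\max(x,0)$. For $f:\Omega_t\to\mathbb{R}$ define the Barron norm $$\|f\|_{\mathcal B(\Omega_t)}:=\inf_\rho\int_{\mathbb{R}^{N_t}\times\mathbb{R}\times\mathbb{R}}|w|\,(\|b\|+|c|)\,\rho(db,dc,dw)\in[0,\infty],$$ where $\|\cdot\|$ is the Euclidean norm and the infimum is over all Borel probability measures $\rho$ on $\mathbb{R}^{N_t}\times\mathbb{R}\times\mathbb{R}$ such that $$f(t)=\int_{\mathbb{R}^{N_t}\times\mathbb{R}\times\mathbb{R}} w\,\sigma(b\cdot t+c)\,\rho(db,dc,dw)\qquad\text{for all }t\in\Omega_t,$$ with absolutely convergent integrals (and $\inf\emptyset=\infty$). The Barron space $\mathcal B(\Omega_t)$ is the set of all $f:\Omega_t\to\mathbb{R}$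 with $\|f\|_{\mathcal B(\Omega_t)}<\infty$. Then $H^l(\Omega_t)\subset\mathcal B(\Omega_t)$: every $f\in H^l(\Omega_t)$ is equal almost everywhere on $\Omega_t$ to a function $g$ that is continuous on $\Omega_t$ and belongs to $\mathcal B(\Omega_t)$. -/

import Mathlib

open MeasureTheory Set
open scoped ENNReal ContDiff

noncomputable section

namespace SobolevBarron

/-- The closed unit cube `[0,1]^N` in Euclidean space `ℝ^N`. -/
def cube (N : ℕ) : Set (EuclideanSpace ℝ (Fin N)) :=
  {t | ∀ i, t i ∈ Icc (0 : ℝ) 1}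

/-- The open unit cube `(0,1)^N`. -/
def openCube (N : ℕ) : Set (EuclideanSpace ℝ (Fin N)) :=
  {t | ∀ i, t i ∈ Ioo (0 : ℝ) 1}

/-- The iterated classical partial derivative `∂_{i 0} ⋯ ∂_{i (k-1)} φ` at `x`.
For smooth `φ` the order of the directions is irrelevant, so that, as `i` runs through the tuples
of length `k`, these are exactly the derivatives `∂^α φ` with `|α| = k`. -/
def partialDeriv {N k : ℕ} (i : Fin k → Fin N) (φ : EuclideanSpace ℝ (Fin N) → ℝ)
    (x : EuclideanSpace ℝ (Fin N)) : ℝ :=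
  iteratedFDeriv ℝ k φ x (fun j => EuclideanSpace.single (i j) (1 : ℝ))

/-- `g` is the weak derivative `∂_{i 0} ⋯ ∂_{i (k-1)} f` on the open set `Ω`, tested against
smooth functions with compact support in `Ω`. -/
def IsWeakDeriv {N k : ℕ} (Ω : Set (EuclideanSpace ℝ (Fin N))) (i : Fin k → Fin N)
    (f g : EuclideanSpace ℝ (Fin N) → ℝ) : Prop :=
  ∀ φ : EuclideanSpace ℝ (Fin N) → ℝ, ContDiff ℝ ∞ φ → HasCompactSupport φ → tsupport φ ⊆ Ω →
    ∫ x in Ω, f x * partialDeriv i φ x = (-1 : ℝ) ^ k * ∫ x in Ω, g x * φ x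

/-- `f` represents an element of the Sobolev space `H^l(Ω) = W^{l,2}(Ω)`, for `Ω` open: `f` and all
its weak derivatives of order at most `l` are in `L²(Ω)`. Only the values of `f` on `Ω` matter. -/
def MemSobolev {N : ℕ} (l : ℕ) (Ω : Set (EuclideanSpace ℝ (Fin N)))
    (f : EuclideanSpace ℝ (Fin N) → ℝ) : Prop :=
  MemLp f 2 (volume.restrict Ω) ∧
    ∀ k ≤ l, ∀ i : Fin k → Fin N, ∃ g : EuclideanSpace ℝ (Fin N) → ℝ,
      MemLp g 2 (volume.restrict Ω) ∧ IsWeakDeriv Ω i f g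

/-- The ReLU activation. -/
def relu (x : ℝ) : ℝ := max x 0

/-- The probability measure `ρ` on the parameters `(b, c, w)` represents `f` on `Ω` as
`f t = ∫ w σ(b · t + c) ρ(db, dc, dw)` for every `t ∈ Ω`, the integrals being absolutely
convergent. -/
def Represents {N : ℕ} (Ω : Set (EuclideanSpace ℝ (Fin N))) (f : EuclideanSpace ℝ (Fin N) → ℝ)
    (ρ : Measure (EuclideanSpace ℝ (Fin N) × ℝ × ℝ)) : Prop :=
  IsProbabilityMeasure ρ ∧
    ∀ t ∈ Ω,
      Integrable (fun p : EuclideanSpace ℝ (Fin N) × ℝ × ℝ =>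
        p.2.2 * relu (inner ℝ p.1 t + p.2.1)) ρ ∧
      f t = ∫ p : EuclideanSpace ℝ (Fin N) × ℝ × ℝ,
        p.2.2 * relu (inner ℝ p.1 t + p.2.1) ∂ρ

/-- The Barron norm: the infimum of `∫ |w| (‖b‖ + |c|) dρ` over all representing `ρ`, with value
`∞` if there is no `ρ` or if all these integrals are infinite. -/
def barronNorm {N : ℕ} (Ω : Set (EuclideanSpace ℝ (Fin N)))
    (f : EuclideanSpace ℝ (Fin N) → ℝ) : ℝ≥0∞ :=
  ⨅ (ρ : Measure (EuclideanSpace ℝ (Fin N) × ℝ × ℝ)) (_ : Represents Ω f ρ),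
    ∫⁻ p, ENNReal.ofReal (|p.2.2| * (‖p.1‖ + |p.2.1|)) ∂ρ

/-- The restriction of `f` to `Ω` belongs to the Barron space of `Ω`. -/
def MemBarron {N : ℕ} (Ω : Set (EuclideanSpace ℝ (Fin N)))
    (f : EuclideanSpace ℝ (Fin N) → ℝ) : Prop :=
  barronNorm Ω f < ⊤

end SobolevBarron

end

noncomputable section

namespace SobolevBarron

/-! Plane waves are cheap to represent. By Taylor's formula with integral remainder, `A cos (β · t +
γ)` is on the cube a superposition of ReLU neurons of total cost at most a constant times `|A| (1 +
‖β‖)^2` (`hasBarronBound_cos`). It therefore suffices to write `f` almost everywhere as the real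
part of a Fourier series of period `2` with `∑ ‖c k‖ (1 + |k|)^2 < ∞` (`memBarron_re_series`): the
measures of the terms are added, and the sum is normalised to a probability measure
(`HasBarronBound.memBarron`).

The `c k` should be the Fourier coefficients of a Sobolev extension of `f` to the torus of period
`2`, built from dilated reflections across the faces. The extension itself is never constructed,
only its transpose acting on characters: `c k = coeff f α k` integrates `f` over the cube against `∏
j, wave α (k j) (x j)`, where `wave α n` is the one-variable transpose applied to the character of
frequency `-n`. By `exists_reflection`, `(-π i n)^l * wave α n` is a sum over `m` of derivatives of
order `l - m` of functions that vanish to order `l - m` at `0` and `1`. Integration by parts in one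
variable then leaves no boundary terms (`IsWeakDeriv.integral_prod`), and Bessel's inequality makes
`(k i)^l * c k` square summable for every `i`. As `2 (l - 2) > N`, the weighted sum above converges
(`summable_coeff_mul_sq`).

That the series recovers `f` is again proved by duality. For smooth `φ` vanishing off `(0,1)`,
Poisson summation gives `∑ (∫ char n * φ) * wave α n = φ` on `(0,1)` (`tsum_mul_wave`), so `f` and
the series have the same integrals against products of such functions. These products include all
plane waves damped by a fixed positive bump, so uniqueness of the Fourier transform yields equality
almost everywhere. -/

/-! ### Barron functions represented by measures that need not be normalised -/

/-- The parameters `(b, c, w)` of a neuron. -/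
abbrev Params (N : ℕ) : Type := EuclideanSpace ℝ (Fin N) × ℝ × ℝ

/-- The cost `|w| (‖b‖ + |c|)` of a neuron. -/
def cost {N : ℕ} (p : Params N) : ℝ := |p.2.2| * (‖p.1‖ + |p.2.1|)

/-- The value of a neuron at `t`. -/
def neuron {N : ℕ} (t : EuclideanSpace ℝ (Fin N)) (p : Params N) : ℝ :=
  p.2.2 * relu (inner ℝ p.1 t + p.2.1)

/-- `f` is represented on the cube by some measure on the parameters of total cost at most `C`. -/
def HasBarronBound {N : ℕ} (f : EuclideanSpace ℝ (Fin N) → ℝ) (C : ℝ≥0∞) : Prop :=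
  ∃ μ : Measure (Params N), ∫⁻ p, ENNReal.ofReal (cost p) ∂μ ≤ C ∧
    ∀ t ∈ cube N, f t = ∫ p, neuron t p ∂μ

variable {N : ℕ}

lemma cost_nonneg (p : Params N) : 0 ≤ cost p := by unfold cost; positivity

lemma continuous_cost : Continuous (cost : Params N → ℝ) := by unfold cost; fun_prop

lemma continuous_relu : Continuous relu := by unfold relu; fun_prop

lemma continuous_neuron (t : EuclideanSpace ℝ (Fin N)) : Continuous (neuron t) := by
  unfold neuron
  exact (by fun_prop : Continuous fun p : Params N => p.2.2).mul
    (continuous_relu.comp (by fun_prop))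

lemma abs_relu_le (x : ℝ) : |relu x| ≤ |x| := by
  unfold relu
  rw [abs_of_nonneg (le_max_right _ _)]
  exact max_le (le_abs_self x) (abs_nonneg x)

lemma abs_neuron_le (t : EuclideanSpace ℝ (Fin N)) (p : Params N) :
    |neuron t p| ≤ (‖t‖ + 1) * cost p := by
  have h1 : |relu (inner ℝ p.1 t + p.2.1)| ≤ ‖p.1‖ * ‖t‖ + |p.2.1| :=
    (abs_relu_le _).trans ((abs_add_le _ _).trans
      (add_le_add (abs_real_inner_le_norm _ _) le_rfl))
  unfold neuron cost
  rw [abs_mul]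
  have h2 : ‖p.1‖ * ‖t‖ + |p.2.1| ≤ (‖t‖ + 1) * (‖p.1‖ + |p.2.1|) := by
    nlinarith [norm_nonneg p.1, norm_nonneg t, abs_nonneg p.2.1,
      mul_nonneg (norm_nonneg t) (abs_nonneg p.2.1)]
  calc |p.2.2| * |relu (inner ℝ p.1 t + p.2.1)|
      ≤ |p.2.2| * ((‖t‖ + 1) * (‖p.1‖ + |p.2.1|)) :=
        mul_le_mul_of_nonneg_left (h1.trans h2) (abs_nonneg _)
    _ = _ := by ring

lemma integrable_cost {μ : Measure (Params N)} (h : ∫⁻ p, ENNReal.ofReal (cost p) ∂μ < ⊤) :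
    Integrable cost μ := by
  refine ⟨continuous_cost.aestronglyMeasurable, ?_⟩
  rwa [hasFiniteIntegral_iff_ofReal (Filter.Eventually.of_forall cost_nonneg)]

lemma integrable_neuron {μ : Measure (Params N)} (h : ∫⁻ p, ENNReal.ofReal (cost p) ∂μ < ⊤)
    (t : EuclideanSpace ℝ (Fin N)) : Integrable (neuron t) μ :=
  ((integrable_cost h).const_mul (‖t‖ + 1)).mono' (continuous_neuron t).aestronglyMeasurable
    (Filter.Eventually.of_forall (abs_neuron_le t))

lemma neuron_eq_zero_of_cost_eq_zero {t : EuclideanSpace ℝ (Fin N)} {p : Params N}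
    (h : cost p = 0) : neuron t p = 0 := by
  have := abs_neuron_le t p
  rw [h, mul_zero] at this
  exact abs_nonpos_iff.1 this

/-- The neuron `p` with its outer weight rescaled so that its cost becomes `Z`. -/
def rescale (Z : ℝ) (p : Params N) : Params N := (p.1, p.2.1, Z / cost p * p.2.2)

lemma measurable_rescale (Z : ℝ) : Measurable (rescale Z : Params N → Params N) := by
  unfold rescale
  have := (continuous_cost (N := N)).measurable
  fun_prop

lemma neuron_rescale {Z : ℝ} (hZ : Z ≠ 0) (t : EuclideanSpace ℝ (Fin N)) (p : Params N) :
    cost p / Z * neuron t (rescale Z p) = neuron t p := by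
  have h : neuron t (rescale Z p) = Z / cost p * neuron t p := by
    simp only [neuron, rescale]; ring
  rw [h]
  by_cases h0 : cost p = 0
  · rw [neuron_eq_zero_of_cost_eq_zero h0]; simp
  · field_simp

lemma cost_rescale_le {Z : ℝ} (hZ : 0 ≤ Z) (p : Params N) : cost (rescale Z p) ≤ Z := by
  have h : cost (rescale Z p) = Z / cost p * cost p := by
    simp only [cost, rescale, abs_mul]
    rw [abs_of_nonneg (div_nonneg hZ (by positivity))]
    ring
  rw [h]
  by_cases h0 : cost p = 0
  · simp [h0, hZ]
  · rw [div_mul_cancel₀ _ h0]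

/-- The density `cost / Z` has mass one, and `rescale Z` multiplies the outer weight by its
reciprocal, so every integral of a neuron is unchanged. Neurons of cost zero are lost, but their
value is zero. -/
lemma represents_withDensity {μ : Measure (Params N)} {f : EuclideanSpace ℝ (Fin N) → ℝ}
    (hμ : ∫⁻ p, ENNReal.ofReal (cost p) ∂μ < ⊤) (hf : ∀ t ∈ cube N, f t = ∫ p, neuron t p ∂μ)
    (hZ : 0 < ∫ p, cost p ∂μ) :
    Represents (cube N) f ((μ.withDensity fun p =>
      ENNReal.ofReal (cost p / ∫ p, cost p ∂μ)).map (rescale (∫ p, cost p ∂μ))) := by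
  set Z := ∫ p, cost p ∂μ with hZdef
  have hdm : Measurable fun p : Params N => ENNReal.ofReal (cost p / Z) :=
    (continuous_cost.measurable.div_const Z).ennreal_ofReal
  have hd1 : ∫⁻ p, ENNReal.ofReal (cost p / Z) ∂μ = 1 := by
    rw [← ofReal_integral_eq_lintegral_ofReal ((integrable_cost hμ).div_const Z)
      (Filter.Eventually.of_forall fun p => div_nonneg (cost_nonneg p) hZ.le), integral_div,
      ← hZdef, div_self hZ.ne', ENNReal.ofReal_one]
  have hr := measurable_rescale (N := N) Z
  have hlt : ∀ᵐ p ∂μ, ENNReal.ofReal (cost p / Z) < ⊤ :=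
    Filter.Eventually.of_forall fun p => ENNReal.ofReal_lt_top
  have key : ∀ t (p : Params N),
      (ENNReal.ofReal (cost p / Z)).toReal • neuron t (rescale Z p) = neuron t p := by
    intro t p
    rw [ENNReal.toReal_ofReal (div_nonneg (cost_nonneg p) hZ.le), smul_eq_mul,
      neuron_rescale hZ.ne']
  refine ⟨⟨?_⟩, fun t ht => ⟨?_, ?_⟩⟩
  · rw [Measure.map_apply hr MeasurableSet.univ, preimage_univ, withDensity_apply _ .univ,
      Measure.restrict_univ, hd1]
  · change Integrable (neuron t) _
    rw [integrable_map_measure (continuous_neuron t).aestronglyMeasurable hr.aemeasurable,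
      integrable_withDensity_iff_integrable_smul' hdm hlt]
    simp only [Function.comp_apply, key]
    exact integrable_neuron hμ t
  · change f t = ∫ p, neuron t p ∂_
    rw [integral_map hr.aemeasurable (continuous_neuron t).aestronglyMeasurable,
      integral_withDensity_eq_integral_toReal_smul hdm hlt]
    simp only [key]
    exact hf t ht

/-- Normalising the cost of every neuron turns a measure of finite total cost into a probability
measure. -/
theorem HasBarronBound.memBarron {f : EuclideanSpace ℝ (Fin N) → ℝ} {C : ℝ≥0∞}
    (h : HasBarronBound f C) (hC : C < ⊤) : MemBarron (cube N) f := by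
  obtain ⟨μ, hμC, hf⟩ := h
  have hμ := hμC.trans_lt hC
  suffices H : ∃ ρ, Represents (cube N) f ρ ∧ ∫⁻ p, ENNReal.ofReal (cost p) ∂ρ < ⊤ by
    obtain ⟨ρ, h1, h2⟩ := H
    exact (iInf₂_le ρ h1).trans_lt h2
  rcases (integral_nonneg cost_nonneg : 0 ≤ ∫ p, cost p ∂μ).eq_or_lt with h0 | hZ
  -- Zero total cost forces `f = 0` on the cube, and the zero neuron represents that.
  · have h0' : cost =ᵐ[μ] 0 :=
      (integral_eq_zero_iff_of_nonneg cost_nonneg (integrable_cost hμ)).1 h0.symm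
    refine ⟨Measure.dirac 0, ⟨inferInstance, fun t ht => ⟨integrable_dirac (by simp), ?_⟩⟩, ?_⟩
    · rw [hf t ht, integral_dirac, integral_eq_zero_of_ae]
      · simp
      · filter_upwards [h0'] with p hp using neuron_eq_zero_of_cost_eq_zero hp
    · rw [lintegral_dirac]; exact ENNReal.ofReal_lt_top
  · have hrep := represents_withDensity hμ hf hZ
    refine ⟨_, hrep, ?_⟩
    have := hrep.1
    refine (lintegral_mono_ae (g := fun _ => ENNReal.ofReal (∫ p, cost p ∂μ)) ?_).trans_lt ?_
    · have hr := measurable_rescale (N := N) (∫ p, cost p ∂μ)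
      rw [ae_map_iff hr.aemeasurable
        (measurableSet_le continuous_cost.measurable.ennreal_ofReal measurable_const)]
      exact Filter.Eventually.of_forall fun p =>
        ENNReal.ofReal_le_ofReal (cost_rescale_le hZ.le p)
    · simp

theorem HasBarronBound.tsum {ι : Type*} {f : ι → EuclideanSpace ℝ (Fin N) → ℝ} {C : ι → ℝ≥0∞}
    {F : EuclideanSpace ℝ (Fin N) → ℝ} (h : ∀ i, HasBarronBound (f i) (C i))
    (hC : ∑' i, C i < ⊤) (hF : ∀ t ∈ cube N, F t = ∑' i, f i t) :
    HasBarronBound F (∑' i, C i) := by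
  choose μ hμ hf using h
  have hle : ∫⁻ p, ENNReal.ofReal (cost p) ∂Measure.sum μ ≤ ∑' i, C i := by
    rw [lintegral_sum_measure]
    exact ENNReal.tsum_le_tsum hμ
  refine ⟨Measure.sum μ, hle, fun t ht => ?_⟩
  rw [hF t ht, integral_sum_measure (integrable_neuron (hle.trans_lt hC) t)]
  exact tsum_congr fun i => hf i t ht

/-! ### Plane waves -/

/-- Taylor's formula of order two at the left end `-R`, with integral remainder. The kernel `relu (u
- s)` vanishes for `s > u`, which makes the interval of integration independent of `u`. -/
lemma cos_eq_integral_relu {R u : ℝ} (γ : ℝ) (hu : u ∈ Icc (-R) R) :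
    Real.cos (u + γ) = Real.cos (-R + γ) - Real.sin (-R + γ) * (u + R) -
      ∫ s in (-R)..R, Real.cos (s + γ) * relu (u - s) := by
  have hc : Continuous fun s => Real.cos (s + γ) * relu (u - s) :=
    (by fun_prop : Continuous fun s => Real.cos (s + γ)).mul
      (continuous_relu.comp (by fun_prop))
  rw [← intervalIntegral.integral_add_adjacent_intervals (hc.intervalIntegrable (-R) u)
    (hc.intervalIntegrable u R)]
  have h2 : ∫ s in u..R, Real.cos (s + γ) * relu (u - s) = 0 := by
    rw [intervalIntegral.integral_congr (g := fun _ => (0 : ℝ))]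
    · simp
    · intro s hs
      rw [uIcc_of_le hu.2] at hs
      have : relu (u - s) = 0 := max_eq_right (by linarith [hs.1])
      simp [this]
  have h1 : ∫ s in (-R)..u, Real.cos (s + γ) * relu (u - s) =
      ∫ s in (-R)..u, Real.cos (s + γ) * (u - s) := by
    refine intervalIntegral.integral_congr fun s hs => ?_
    rw [uIcc_of_le hu.1] at hs
    have : relu (u - s) = u - s := max_eq_left (by linarith [hs.2])
    simp [this]
  have h3 : ∫ s in (-R)..u, Real.cos (s + γ) * (u - s) =
      (Real.sin (u + γ) * (u - u) - Real.cos (u + γ)) -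
        (Real.sin (-R + γ) * (u - -R) - Real.cos (-R + γ)) := by
    refine intervalIntegral.integral_eq_sub_of_hasDerivAt
      (f := fun s => Real.sin (s + γ) * (u - s) - Real.cos (s + γ)) (fun s _ => ?_) ?_
    · have hs : HasDerivAt (fun s => s + γ) 1 s := (hasDerivAt_id s).add_const γ
      exact ((hs.sin.mul ((hasDerivAt_id s).const_sub u)).sub hs.cos).congr_deriv (by simp)
    · exact (by fun_prop : Continuous fun s => Real.cos (s + γ) * (u - s)).intervalIntegrable _ _
  rw [h2, h1, h3]
  ring

lemma norm_le_of_mem_cube {t : EuclideanSpace ℝ (Fin N)} (ht : t ∈ cube N) : ‖t‖ ≤ √N := by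
  rw [EuclideanSpace.norm_eq]
  refine Real.sqrt_le_sqrt ?_
  calc ∑ i, ‖t i‖ ^ 2 ≤ ∑ _i : Fin N, (1 : ℝ) := by
        refine Finset.sum_le_sum fun i _ => ?_
        rw [Real.norm_eq_abs, sq_abs]
        have := ht i
        nlinarith [this.1, this.2]
    _ = N := by simp

theorem hasBarronBound_cos (A γ : ℝ) (β : EuclideanSpace ℝ (Fin N)) :
    HasBarronBound (fun t => A * Real.cos (inner ℝ β t + γ))
      (ENNReal.ofReal (|A| * (3 * (1 + √N) ^ 2 * (1 + ‖β‖) ^ 2))) := by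
  -- Since `‖t‖ ≤ √N` on the cube, `β · t` stays in `[-R, R]`.
  set R := ‖β‖ * √N with hR
  have hR0 : 0 ≤ R := by positivity
  -- The three terms of the Taylor formula: a constant neuron, a neuron that is always active
  -- because `β · t + R ≥ 0`, and a family indexed by the kink `s`.
  let p1 : Params N := (0, 1, A * Real.cos (-R + γ))
  let p2 : Params N := (β, R, -(A * Real.sin (-R + γ)))
  let q : ℝ → Params N := fun s => (β, -s, -(A * Real.cos (s + γ)))
  have hq : Continuous q := by fun_prop
  let ν : Measure (Params N) := (volume.restrict (Ioc (-R) R)).map q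
  have c1 : ∫⁻ p, ENNReal.ofReal (cost p) ∂(Measure.dirac p1) ≤ ENNReal.ofReal |A| := by
    rw [lintegral_dirac]
    refine ENNReal.ofReal_le_ofReal ?_
    simp only [cost, p1, norm_zero, abs_one, zero_add, mul_one, abs_mul]
    exact mul_le_of_le_one_right (abs_nonneg _) (Real.abs_cos_le_one _)
  have c2 : ∫⁻ p, ENNReal.ofReal (cost p) ∂(Measure.dirac p2) ≤
      ENNReal.ofReal (|A| * (‖β‖ + R)) := by
    rw [lintegral_dirac]
    refine ENNReal.ofReal_le_ofReal ?_
    simp only [cost, p2, abs_neg, abs_mul, abs_of_nonneg hR0]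
    exact mul_le_mul_of_nonneg_right
      (mul_le_of_le_one_right (abs_nonneg _) (Real.abs_sin_le_one _)) (by positivity)
  have c3 : ∫⁻ p, ENNReal.ofReal (cost p) ∂ν ≤ ENNReal.ofReal (|A| * (‖β‖ + R) * (2 * R)) := by
    rw [lintegral_map continuous_cost.measurable.ennreal_ofReal hq.measurable]
    calc ∫⁻ s in Ioc (-R) R, ENNReal.ofReal (cost (q s))
        ≤ ∫⁻ _s in Ioc (-R) R, ENNReal.ofReal (|A| * (‖β‖ + R)) := by
          refine setLIntegral_mono measurable_const fun s hs => ENNReal.ofReal_le_ofReal ?_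
          simp only [cost, q, abs_neg, abs_mul]
          refine mul_le_mul (mul_le_of_le_one_right (abs_nonneg _) (Real.abs_cos_le_one _)) ?_
            (by positivity) (abs_nonneg _)
          exact add_le_add le_rfl (abs_le.2 ⟨hs.1.le, hs.2⟩)
      _ = _ := by
          rw [setLIntegral_const, Real.volume_Ioc, ← ENNReal.ofReal_mul (by positivity)]
          congr 1; ring
  refine ⟨Measure.dirac p1 + Measure.dirac p2 + ν, ?_, fun t ht => ?_⟩
  · rw [lintegral_add_measure, lintegral_add_measure]
    refine (add_le_add (add_le_add c1 c2) c3).trans ?_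
    rw [← ENNReal.ofReal_add (by positivity) (by positivity),
      ← ENNReal.ofReal_add (by positivity) (by positivity)]
    refine ENNReal.ofReal_le_ofReal ?_
    have hb := norm_nonneg β
    have hs := Real.sqrt_nonneg (N : ℝ)
    have : 1 + (‖β‖ + R) + (‖β‖ + R) * (2 * R) ≤ 3 * (1 + √N) ^ 2 * (1 + ‖β‖) ^ 2 := by
      have e : ‖β‖ + R = ‖β‖ * (1 + √N) := by rw [hR]; ring
      rw [e]
      set X := 1 + √N with hX
      have hX1 : 1 ≤ X := by linarith
      have hR' : R ≤ ‖β‖ * X := by rw [hR]; nlinarith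
      have h1 : ‖β‖ * X * (2 * R) ≤ ‖β‖ * X * (2 * (‖β‖ * X)) :=
        mul_le_mul_of_nonneg_left (by linarith) (by positivity)
      have h2 : 0 ≤ ‖β‖ * X := by positivity
      have h3 : (1 + ‖β‖ * X) ^ 2 ≤ (X * (1 + ‖β‖)) ^ 2 :=
        pow_le_pow_left₀ (by positivity) (by nlinarith) 2
      nlinarith
    calc _ = |A| * (1 + (‖β‖ + R) + (‖β‖ + R) * (2 * R)) := by ring
      _ ≤ _ := mul_le_mul_of_nonneg_left this (abs_nonneg _)
  · have i1 := integrable_neuron (c1.trans_lt ENNReal.ofReal_lt_top) t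
    have i2 := integrable_neuron (c2.trans_lt ENNReal.ofReal_lt_top) t
    have i3 := integrable_neuron (c3.trans_lt ENNReal.ofReal_lt_top) t
    have hu : inner ℝ β t ∈ Icc (-R) R := by
      rw [mem_Icc, ← abs_le]
      exact (abs_real_inner_le_norm _ _).trans
        (mul_le_mul_of_nonneg_left (norm_le_of_mem_cube ht) (norm_nonneg _))
    rw [integral_add_measure (i1.add_measure i2) i3, integral_add_measure i1 i2, integral_dirac,
      integral_dirac, integral_map hq.measurable.aemeasurable
        (continuous_neuron t).aestronglyMeasurable,
      ← intervalIntegral.integral_of_le (by linarith)]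
    have e1 : neuron t p1 = A * Real.cos (-R + γ) := by
      simp [neuron, p1, relu]
    have e2 : neuron t p2 = -(A * Real.sin (-R + γ)) * (inner ℝ β t + R) := by
      have : relu (inner ℝ β t + R) = inner ℝ β t + R := max_eq_left (by linarith [hu.1])
      simp only [neuron, p2, this]
    have e3 : ∀ s, neuron t (q s) = -A * (Real.cos (s + γ) * relu (inner ℝ β t - s)) := by
      intro s; simp only [neuron, q, ← sub_eq_add_neg]; ring
    simp only [e1, e2, e3]
    rw [intervalIntegral.integral_const_mul, cos_eq_integral_relu γ hu]
    ring

/-! ### Products of functions of one variable -/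

/-- Fubini for absolutely convergent series, one coordinate split off at a time. It reduces the
reconstruction in several variables to the one in a single variable. -/
theorem hasSum_prod_pi {N : ℕ} (f : Fin N → ℤ → ℂ) (hf : ∀ j, Summable fun n => ‖f j n‖) :
    (Summable fun k : Fin N → ℤ => ‖∏ j, f j (k j)‖) ∧
      HasSum (fun k : Fin N → ℤ => ∏ j, f j (k j)) (∏ j, ∑' n, f j n) := by
  induction N with
  | zero => exact ⟨(hasSum_fintype _).summable, by simp⟩
  | succ N ih =>
    obtain ⟨h1, h2⟩ := ih (fun j => f j.succ) fun j => hf j.succ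
    obtain ⟨G, hG⟩ : ∃ G : (Fin N → ℤ) → ℂ, G = fun k => ∏ j : Fin N, f j.succ (k j) := ⟨_, rfl⟩
    rw [← hG] at h2
    have h1' : Summable fun k => ‖G k‖ := by rw [hG]; exact h1
    have h4 : Summable fun p : ℤ × (Fin N → ℤ) => ‖f 0 p.1 * G p.2‖ :=
      Summable.mul_norm (f := f 0) (g := G) (hf 0) h1'
    have h5 := (hf 0).of_norm.hasSum.mul h2 h4.of_norm
    have key : ∀ p : ℤ × (Fin N → ℤ), ∏ j, f j ((Fin.consEquiv fun _ : Fin (N + 1) => ℤ) p j) =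
        f 0 p.1 * G p.2 := by
      intro p
      rw [Fin.prod_univ_succ, hG]
      simp [Fin.consEquiv]
    constructor
    · rw [← (Fin.consEquiv fun _ : Fin (N + 1) => ℤ).summable_iff]
      refine h4.congr fun p => ?_
      rw [Function.comp_apply, key]
    · rw [← (Fin.consEquiv fun _ : Fin (N + 1) => ℤ).hasSum_iff, Fin.prod_univ_succ]
      rw [show (fun k : Fin (N + 1) → ℤ => ∏ j, f j (k j)) ∘
        (Fin.consEquiv fun _ : Fin (N + 1) => ℤ) = fun p => f 0 p.1 * G p.2 from funext key]
      exact h5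

/-- The points of Euclidean space all of whose coordinates lie in `A`. -/
def box (N : ℕ) (A : Set ℝ) : Set (EuclideanSpace ℝ (Fin N)) := {t | ∀ i, t i ∈ A}

lemma openCube_eq_box : openCube N = box N (Ioo 0 1) := rfl

lemma cube_eq_box : cube N = box N (Icc 0 1) := rfl

lemma toLp_preimage_box (A : Set ℝ) :
    (WithLp.toLp 2 : (Fin N → ℝ) → EuclideanSpace ℝ (Fin N)) ⁻¹' box N A = univ.pi fun _ => A := by
  ext x; simp [box]

lemma measurableSet_box {A : Set ℝ} (hA : MeasurableSet A) : MeasurableSet (box N A) := by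
  have : box N A = ⋂ i, (fun t : EuclideanSpace ℝ (Fin N) => t i) ⁻¹' A := by
    ext; simp [box]
  rw [this]
  exact MeasurableSet.iInter fun i => (by fun_prop : Measurable fun t : EuclideanSpace ℝ (Fin N) => t i) hA

lemma measurePreserving_toLp_box {A : Set ℝ} (hA : MeasurableSet A) :
    MeasurePreserving (WithLp.toLp 2 : (Fin N → ℝ) → EuclideanSpace ℝ (Fin N))
      (Measure.pi fun _ => volume.restrict A) (volume.restrict (box N A)) := by
  have h := (PiLp.volume_preserving_toLp (Fin N)).restrict_preimage (measurableSet_box (N := N) hA)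
  rwa [toLp_preimage_box, volume_pi, Measure.restrict_pi_pi] at h

lemma integral_box_prod {A : Set ℝ} (hA : MeasurableSet A) (u : Fin N → ℝ → ℂ) :
    ∫ x in box N A, ∏ j, u j (x j) = ∏ j, ∫ y in A, u j y := by
  rw [← integral_fintype_prod_eq_prod, ← (measurePreserving_toLp_box hA).integral_comp
    (MeasurableEquiv.toLp 2 (Fin N → ℝ)).measurableEmbedding]

lemma openCube_ae_eq_cube : openCube N =ᵐ[volume] cube N := by
  have h := (Measure.univ_pi_Ioo_ae_eq_Icc (μ := fun _ : Fin N => (volume : Measure ℝ))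
    (f := fun _ => 0) (g := fun _ => 1))
  rw [← pi_univ_Icc, ← volume_pi, ← toLp_preimage_box, ← toLp_preimage_box] at h
  have hm := PiLp.volume_preserving_toLp (Fin N)
  rw [openCube_eq_box, cube_eq_box]
  rw [← measure_symmDiff_eq_zero_iff] at h ⊢
  rw [← preimage_symmDiff, hm.measure_preimage] at h
  · exact h
  · exact ((measurableSet_box measurableSet_Ioo).symmDiff
      (measurableSet_box measurableSet_Icc)).nullMeasurableSet

lemma volume_box_lt_top {A : Set ℝ} (hA : MeasurableSet A) (h : volume A < ⊤) :
    volume (box N A) < ⊤ := by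
  have hm := (PiLp.volume_preserving_toLp (Fin N)).measure_preimage
    (measurableSet_box (N := N) hA).nullMeasurableSet
  rw [toLp_preimage_box, volume_pi_pi] at hm
  rw [← hm]
  exact ENNReal.prod_lt_top fun _ _ => h

/-! ### Characters and Bessel's inequality -/

/-- The character `x ↦ exp (π i n x)` of period `2`. -/
def char (n : ℤ) (x : ℝ) : ℂ := Complex.exp (Real.pi * Complex.I * n * x)

lemma char_eq_exp (n : ℤ) (x : ℝ) : char n x = Complex.exp ((Real.pi * n * x : ℝ) * Complex.I) := by
  unfold char; push_cast; ring_nf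

lemma norm_char (n : ℤ) (x : ℝ) : ‖char n x‖ = 1 := by
  rw [char_eq_exp, Complex.norm_exp_ofReal_mul_I]

lemma char_mul_char (m n : ℤ) (x : ℝ) : char m x * char n x = char (m + n) x := by
  simp only [char, ← Complex.exp_add]; congr 1; push_cast; ring

lemma conj_char (n : ℤ) (x : ℝ) : (starRingEnd ℂ) (char n x) = char (-n) x := by
  simp only [char, ← Complex.exp_conj]; congr 1; simp

lemma char_zero_left (x : ℝ) : char 0 x = 1 := by simp [char]

lemma char_zero_right (n : ℤ) : char n 0 = 1 := by simp [char]

lemma contDiff_char (n : ℤ) : ContDiff ℝ ∞ (char n) := by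
  unfold char
  exact Complex.contDiff_exp.comp (contDiff_const.mul Complex.ofRealCLM.contDiff)

lemma continuous_char (n : ℤ) : Continuous (char n) := (contDiff_char n).continuous

lemma char_two_mul (n m : ℤ) : char n (2 * m) = 1 := by
  unfold char
  rw [Complex.exp_eq_one_iff]
  exact ⟨n * m, by push_cast; ring⟩

lemma integral_char (n : ℤ) : ∫ y in Ioo (-1 : ℝ) 1, char n y = if n = 0 then 2 else 0 := by
  rw [← integral_Ioc_eq_integral_Ioo, ← intervalIntegral.integral_of_le (by norm_num)]
  split_ifs with h
  · subst h; simp [char_zero_left]; norm_num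
  · have hc : (Real.pi * Complex.I * n : ℂ) ≠ 0 := by
      simp [Real.pi_ne_zero, h]
    unfold char
    rw [integral_exp_mul_complex hc]
    have h1 : Complex.exp (Real.pi * Complex.I * n * (1 : ℝ)) =
        Complex.exp (Real.pi * Complex.I * n * (-1 : ℝ)) := by
      rw [Complex.exp_eq_exp_iff_exists_int]
      exact ⟨n, by push_cast; ring⟩
    rw [h1]; simp

/-- The `N`-dimensional character with frequency `k`. -/
def charN (k : Fin N → ℤ) (x : EuclideanSpace ℝ (Fin N)) : ℂ := ∏ j, char (k j) (x j)

lemma norm_charN (k : Fin N → ℤ) (x : EuclideanSpace ℝ (Fin N)) : ‖charN k x‖ = 1 := by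
  simp [charN, norm_char]

lemma continuous_charN (k : Fin N → ℤ) : Continuous (charN k) := by
  unfold charN
  exact continuous_finsetProd _ fun j _ => (continuous_char _).comp (by fun_prop)

lemma isFiniteMeasure_box : IsFiniteMeasure
    (volume.restrict (box N (Ioo (-1) 1)) : Measure (EuclideanSpace ℝ (Fin N))) :=
  ⟨by rw [Measure.restrict_apply_univ]; exact volume_box_lt_top measurableSet_Ioo (by simp)⟩

lemma integral_conj_charN_mul (k m : Fin N → ℤ) :
    ∫ x in box N (Ioo (-1) 1), (starRingEnd ℂ) (charN k x) * charN m x =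
      if k = m then 2 ^ N else 0 := by
  have h : ∀ x : EuclideanSpace ℝ (Fin N), (starRingEnd ℂ) (charN k x) * charN m x =
      ∏ j, char (-k j + m j) (x j) := by
    intro x
    simp only [charN, map_prod, conj_char, ← Finset.prod_mul_distrib, char_mul_char]
  simp only [h]
  rw [integral_box_prod measurableSet_Ioo fun j => char (-k j + m j)]
  simp only [integral_char]
  split_ifs with hkm
  · subst hkm; simp
  · obtain ⟨j, hj⟩ := Function.ne_iff.1 hkm
    exact Finset.prod_eq_zero (Finset.mem_univ j) (if_neg (by omega))

/-- Bessel's inequality for the characters of period `2`, qualitatively. -/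
theorem summable_sq_fourier {h : EuclideanSpace ℝ (Fin N) → ℂ}
    (hh : MemLp h 2 (volume.restrict (box N (Ioo (-1) 1)))) :
    Summable fun k : Fin N → ℤ => ‖∫ x in box N (Ioo (-1) 1), charN k x * h x‖ ^ 2 := by
  have := isFiniteMeasure_box (N := N)
  set ν : Measure (EuclideanSpace ℝ (Fin N)) := volume.restrict (box N (Ioo (-1) 1)) with hν
  have hmem : ∀ k : Fin N → ℤ, MemLp (charN k) 2 ν := fun k =>
    MemLp.of_bound (continuous_charN k).aestronglyMeasurable 1
      (Filter.Eventually.of_forall fun x => (norm_charN k x).le)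
  have hip : ∀ (k : Fin N → ℤ) (g : EuclideanSpace ℝ (Fin N) → ℂ) (hg : MemLp g 2 ν),
      inner ℂ ((hmem k).toLp) (hg.toLp) = ∫ x, (starRingEnd ℂ) (charN k x) * g x ∂ν := by
    intro k g hg
    rw [MeasureTheory.L2.inner_def]
    refine integral_congr_ae ?_
    filter_upwards [(hmem k).coeFn_toLp, hg.coeFn_toLp] with x h1 h2
    rw [h1, h2, RCLike.inner_apply, mul_comm]
  have hs : ((√2 ^ N : ℝ) : ℂ) * (√2 ^ N : ℝ) = 2 ^ N := by
    rw [← Complex.ofReal_mul, ← mul_pow, Real.mul_self_sqrt zero_le_two]; push_cast; rfl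
  have hs0 : ((√2 ^ N : ℝ) : ℂ) ≠ 0 := by
    rw [Complex.ofReal_ne_zero]; positivity
  have hon : Orthonormal ℂ fun k : Fin N → ℤ =>
      (((√2 ^ N : ℝ) : ℂ)⁻¹ • (hmem k).toLp : Lp ℂ 2 ν) := by
    rw [orthonormal_iff_ite]
    intro k m
    rw [inner_smul_left, inner_smul_right, hip, integral_conj_charN_mul, map_inv₀,
      Complex.conj_ofReal]
    split_ifs
    · rw [← hs]; field_simp
    · simp
  have hsum := (hon.inner_products_summable hh.toLp).mul_left (‖((√2 ^ N : ℝ) : ℂ)‖ ^ 2)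
  have hsum' : Summable fun k : Fin N → ℤ => ‖∫ x, (starRingEnd ℂ) (charN k x) * h x ∂ν‖ ^ 2 := by
    refine hsum.congr fun k => ?_
    rw [← mul_pow, ← norm_mul, inner_smul_left, hip, map_inv₀, Complex.conj_ofReal, ← mul_assoc,
      mul_inv_cancel₀ hs0, one_mul]
  -- The inner product conjugates the character; `k ↦ -k` undoes this.
  rw [← (Equiv.neg (Fin N → ℤ)).summable_iff] at hsum'
  refine hsum'.congr fun k => ?_
  simp only [Function.comp_apply, Equiv.neg_apply]
  congr 3
  ext x
  congr 1
  simp only [charN, map_prod, conj_char, Pi.neg_apply, neg_neg]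

/-! ### Calculus in one variable -/

lemma contDiff_iteratedDeriv {u : ℝ → ℂ} (hu : ContDiff ℝ ∞ u) (m : ℕ) :
    ContDiff ℝ ∞ (iteratedDeriv m u) := by
  rw [iteratedDeriv_eq_iterate]
  exact hu.iterate_deriv m

lemma continuous_iteratedDeriv' {u : ℝ → ℂ} (hu : ContDiff ℝ ∞ u) (m : ℕ) :
    Continuous (iteratedDeriv m u) := (contDiff_iteratedDeriv hu m).continuous

lemma contDiffAt_natCast {u : ℝ → ℂ} (hu : ContDiff ℝ ∞ u) (m : ℕ) (x : ℝ) :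
    ContDiffAt ℝ m u x := (hu.of_le (by exact_mod_cast le_top)).contDiffAt

lemma iteratedDeriv_mul_leibniz {u v : ℝ → ℂ} (hu : ContDiff ℝ ∞ u) (hv : ContDiff ℝ ∞ v) (n : ℕ)
    (x : ℝ) : iteratedDeriv n (fun y => u y * v y) x = ∑ i ∈ Finset.range (n + 1),
      (n.choose i : ℂ) * iteratedDeriv i u x * iteratedDeriv (n - i) v x :=
  iteratedDeriv_fun_mul (contDiffAt_natCast hu n x) (contDiffAt_natCast hv n x)

/-- The inverse Leibniz rule: `κ D^l u` is a combination of the functions `D^(l-m) (κ^(m) u)`. -/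
theorem exists_inverse_leibniz (l : ℕ) : ∃ c : ℕ → ℂ, c 0 = 1 ∧
    ∀ κ u : ℝ → ℂ, ContDiff ℝ ∞ κ → ContDiff ℝ ∞ u → ∀ x,
      κ x * iteratedDeriv l u x = ∑ m ∈ Finset.range (l + 1),
        c m * iteratedDeriv (l - m) (fun y => iteratedDeriv m κ y * u y) x := by
  induction l with
  | zero => exact ⟨fun _ => 1, rfl, fun κ u _ _ x => by simp⟩
  | succ l ih =>
    obtain ⟨c, hc0, hc⟩ := ih
    -- From `κ D^(l+1) u = D (κ D^l u) - κ' D^l u`: the formula for `κ'` is that for `κ` with `m`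
    -- shifted by one. The test `m ≤ l` discards the unspecified value `c (l + 1)`.
    refine ⟨fun m => (if m ≤ l then c m else 0) - (if m = 0 then 0 else c (m - 1)), by simp [hc0],
      fun κ u hκ hu x => ?_⟩
    have hs : ∀ m, ContDiff ℝ ∞ fun y => iteratedDeriv m κ y * u y := fun m =>
      (contDiff_iteratedDeriv hκ m).mul hu
    have hd : ∀ {v : ℝ → ℂ}, ContDiff ℝ ∞ v → ∀ y, DifferentiableAt ℝ v y := fun hv y =>
      hv.contDiffAt.differentiableAt (by simp)
    have h1 := congrArg (fun F : ℝ → ℂ => deriv F x) (funext (hc κ u hκ hu))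
    have h2 := hc (deriv κ) u (by simpa using contDiff_iteratedDeriv hκ 1) hu x
    rw [deriv_fun_mul (hd hκ x) (hd (contDiff_iteratedDeriv hu l) x), h2, ← iteratedDeriv_succ] at h1
    rw [deriv_fun_sum fun m _ => ((hd (contDiff_iteratedDeriv (hs m) (l - m)) x).const_mul _)] at h1
    simp only [← iteratedDeriv_succ'] at h1
    rw [eq_sub_of_add_eq' h1]
    simp only [sub_mul, Finset.sum_sub_distrib]
    congr 1
    · rw [Finset.sum_range_succ _ (l + 1)]
      simp only [Nat.not_succ_le_self, if_false, zero_mul, add_zero]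
      refine Finset.sum_congr rfl fun m hm => ?_
      have hm' : m ≤ l := by simpa [Nat.lt_succ_iff] using hm
      rw [if_pos hm', deriv_const_mul _ (hd (contDiff_iteratedDeriv (hs m) (l - m)) x),
        ← iteratedDeriv_succ, Nat.succ_sub hm']
    · rw [Finset.sum_range_succ' _ (l + 1)]
      simp only [if_true, zero_mul, add_zero, Nat.succ_ne_zero, if_false, Nat.add_sub_cancel]
      refine Finset.sum_congr rfl fun m _ => ?_
      rw [Nat.add_sub_add_right]

/-- Induction on the order: the bound `C x ^ p` for `deriv u` on `[0, x]` and the mean value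
inequality give one more factor `x`. -/
lemma exists_norm_le_pow {p : ℕ} {u : ℝ → ℂ} (hu : ContDiff ℝ ∞ u)
    (h0 : ∀ q < p, iteratedDeriv q u 0 = 0) :
    ∃ C, 0 ≤ C ∧ ∀ x ∈ Icc (0 : ℝ) 1, ‖u x‖ ≤ C * x ^ p := by
  induction p generalizing u with
  | zero =>
    obtain ⟨C, hC⟩ := isCompact_Icc.exists_bound_of_continuousOn
      (hu.continuous.continuousOn (s := Icc (0 : ℝ) 1))
    exact ⟨C, (norm_nonneg _).trans (hC 0 (by simp)), fun x hx => by simpa using hC x hx⟩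
  | succ p ih =>
    obtain ⟨C, hC0, hC⟩ := ih (u := deriv u) (by simpa using contDiff_iteratedDeriv hu 1)
      fun q hq => by rw [← iteratedDeriv_succ']; exact h0 _ (by omega)
    refine ⟨C, hC0, fun x hx => ?_⟩
    have hx' : ∀ y ∈ Icc 0 x, ‖deriv u y‖ ≤ C * x ^ p := fun y hy =>
      (hC y ⟨hy.1, hy.2.trans hx.2⟩).trans
        (mul_le_mul_of_nonneg_left (pow_le_pow_left₀ hy.1 hy.2 p) hC0)
    have := Convex.norm_image_sub_le_of_norm_deriv_le (f := u)
      (fun y _ => hu.contDiffAt.differentiableAt (by simp)) hx' (convex_Icc 0 x)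
      (left_mem_Icc.2 hx.1) (right_mem_Icc.2 hx.1)
    rw [show u 0 = 0 by simpa using h0 0 (by omega), sub_zero, sub_zero, Real.norm_eq_abs,
      abs_of_nonneg hx.1] at this
    rw [pow_succ, ← mul_assoc]
    exact this

lemma exists_norm_le_pow_two_sided {p : ℕ} {u : ℝ → ℂ} (hu : ContDiff ℝ ∞ u)
    (h0 : ∀ q < p, iteratedDeriv q u 0 = 0) (h1 : ∀ q < p, iteratedDeriv q u 1 = 0) :
    ∃ C, 0 ≤ C ∧ ∀ x ∈ Icc (0 : ℝ) 1, ‖u x‖ ≤ C * (x * (1 - x)) ^ p := by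
  obtain ⟨C, hC0, hC⟩ := exists_norm_le_pow hu h0
  obtain ⟨D, hD0, hD⟩ := exists_norm_le_pow (u := fun x => u (1 - x)) (p := p)
    (hu.comp (contDiff_const.sub contDiff_id)) fun q hq => by
      rw [iteratedDeriv_comp_const_sub]; simp [h1 q hq]
  -- At each point one of `2 x` and `2 (1 - x)` is at least `1`, so the factor `2 ^ p` absorbs the
  -- endpoint that is far away.
  refine ⟨2 ^ p * (C + D), by positivity, fun x hx => ?_⟩
  have e : 2 ^ p * (C + D) * (x * (1 - x)) ^ p =
      C * (x * (2 * (1 - x))) ^ p + D * ((2 * x) * (1 - x)) ^ p := by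
    simp only [mul_pow]; ring
  have hx1 : 0 ≤ 1 - x := by linarith [hx.2]
  have hx0 := hx.1
  rw [e]
  rcases le_total x (1 / 2) with h | h
  · have : C * x ^ p ≤ C * (x * (2 * (1 - x))) ^ p :=
      mul_le_mul_of_nonneg_left (pow_le_pow_left₀ hx0 (by nlinarith) p) hC0
    have h2 : 0 ≤ D * ((2 * x) * (1 - x)) ^ p := by positivity
    linarith [hC x hx]
  · have : D * (1 - x) ^ p ≤ D * ((2 * x) * (1 - x)) ^ p :=
      mul_le_mul_of_nonneg_left (pow_le_pow_left₀ hx1 (by nlinarith) p) hD0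
    have h2 : 0 ≤ C * (x * (2 * (1 - x))) ^ p := by positivity
    have h3 := hD (1 - x) ⟨hx1, by linarith⟩
    rw [sub_sub_cancel] at h3
    linarith

/-! ### Cutoff functions -/

/-- A smooth step, `0` on `(-∞, 1]` and `1` on `[2, ∞)`. -/
def step (y : ℝ) : ℂ := (Real.smoothTransition (y - 1) : ℝ)

lemma contDiff_step : ContDiff ℝ ∞ step :=
  Complex.ofRealCLM.contDiff.comp (Real.smoothTransition.contDiff.comp
    (contDiff_id.sub contDiff_const))

lemma step_eq_one {y : ℝ} (hy : 2 ≤ y) : step y = 1 := by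
  rw [step, Real.smoothTransition.one_of_one_le (by linarith), Complex.ofReal_one]

lemma step_eq_zero {y : ℝ} (hy : y ≤ 1) : step y = 0 := by
  rw [step, Real.smoothTransition.zero_of_nonpos (by linarith), Complex.ofReal_zero]

/-- Compactness handles `[0, 2]`; beyond `2` the function is constant. -/
lemma exists_bound_step (p : ℕ) : ∃ C, 0 ≤ C ∧ ∀ y, 0 ≤ y →
    y ^ p * ‖iteratedDeriv p step y‖ ≤ C := by
  obtain ⟨C, hC⟩ := isCompact_Icc.exists_bound_of_continuousOn (s := Icc (0 : ℝ) 2)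
    (f := fun y : ℝ => y ^ p * ‖iteratedDeriv p step y‖)
    ((continuous_pow p).mul (continuous_iteratedDeriv' contDiff_step p).norm).continuousOn
  have hC' : ∀ y ∈ Icc (0 : ℝ) 2, y ^ p * ‖iteratedDeriv p step y‖ ≤ C := fun y hy =>
    (le_abs_self _).trans (hC y hy)
  have hC0 : 0 ≤ C := le_trans (by positivity) (hC' 0 (by simp))
  refine ⟨C + 1, by positivity, fun y hy => ?_⟩
  rcases le_or_gt y 2 with h | h
  · linarith [hC' y ⟨hy, h⟩]
  · have he : step =ᶠ[nhds y] fun _ => 1 := by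
      filter_upwards [lt_mem_nhds h] with z hz using step_eq_one hz.le
    rw [he.iteratedDeriv_eq, iteratedDeriv_const]
    split_ifs with hp
    · subst hp; simp; linarith
    · simp; linarith

/-- A cutoff supported in `[1/n, 1 - 1/n]` that equals `1` on `[2/n, 1 - 2/n]`. -/
def cutoff (n : ℕ) (x : ℝ) : ℂ := step (n * x) * step (n * (1 - x))

lemma contDiff_step_mul (n : ℕ) : ContDiff ℝ ∞ fun x : ℝ => step (n * x) :=
  contDiff_step.comp (contDiff_const.mul contDiff_id)

lemma contDiff_step_mul_sub (n : ℕ) : ContDiff ℝ ∞ fun x : ℝ => step (n * (1 - x)) :=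
  contDiff_step.comp (contDiff_const.mul (contDiff_const.sub contDiff_id))

lemma contDiff_cutoff (n : ℕ) : ContDiff ℝ ∞ (cutoff n) :=
  (contDiff_step_mul n).mul (contDiff_step_mul_sub n)

/-- The quantity `y ^ p * ‖D^p step y‖` is invariant under dilation, hence the uniformity in `n`. -/
lemma exists_bound_step_mul (p : ℕ) : ∃ C, 0 ≤ C ∧ ∀ (n : ℕ) (x : ℝ), 0 ≤ x →
    x ^ p * ‖iteratedDeriv p (fun x : ℝ => step (n * x)) x‖ ≤ C := by
  obtain ⟨C, hC0, hC⟩ := exists_bound_step p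
  refine ⟨C, hC0, fun n x hx => ?_⟩
  rw [iteratedDeriv_comp_const_smul (contDiff_step.of_le (by exact_mod_cast le_top))]
  refine le_trans (le_of_eq ?_) (hC (n * x) (by positivity))
  rw [norm_smul, norm_pow, RCLike.norm_natCast]
  ring

lemma exists_bound_step_mul_sub (p : ℕ) : ∃ C, 0 ≤ C ∧ ∀ (n : ℕ) (x : ℝ), x ≤ 1 →
    (1 - x) ^ p * ‖iteratedDeriv p (fun x : ℝ => step (n * (1 - x))) x‖ ≤ C := by
  obtain ⟨C, hC0, hC⟩ := exists_bound_step_mul p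
  refine ⟨C, hC0, fun n x hx => ?_⟩
  rw [iteratedDeriv_comp_const_sub p (fun y : ℝ => step (n * y)) 1]
  refine le_trans (le_of_eq ?_) (hC n (1 - x) (by linarith))
  rw [norm_smul, norm_pow, norm_neg, norm_one, one_pow, one_mul]

/-- Each derivative of the cutoff costs at most one factor `1 / (x (1 - x))`, uniformly in `n`. This
is exactly what a function vanishing at both ends can compensate. -/
lemma exists_bound_cutoff (m : ℕ) : ∃ C, 0 ≤ C ∧ ∀ (n : ℕ), ∀ x ∈ Icc (0 : ℝ) 1,
    (x * (1 - x)) ^ m * ‖iteratedDeriv m (cutoff n) x‖ ≤ C := by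
  choose C hC0 hC using exists_bound_step_mul
  choose D hD0 hD using exists_bound_step_mul_sub
  refine ⟨∑ i ∈ Finset.range (m + 1), m.choose i * C i * D (m - i),
    Finset.sum_nonneg fun i _ => mul_nonneg (mul_nonneg (by positivity) (hC0 i)) (hD0 _),
    fun n x hx => ?_⟩
  have hx0 := hx.1
  have hx1 : 0 ≤ 1 - x := by linarith [hx.2]
  unfold cutoff
  rw [iteratedDeriv_mul_leibniz (contDiff_step_mul n) (contDiff_step_mul_sub n)]
  refine (mul_le_mul_of_nonneg_left (norm_sum_le _ _) (by positivity)).trans ?_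
  rw [Finset.mul_sum]
  refine Finset.sum_le_sum fun i hi => ?_
  have hi' : i ≤ m := by simpa [Nat.lt_succ_iff] using hi
  rw [norm_mul, norm_mul, RCLike.norm_natCast]
  set a := ‖iteratedDeriv i (fun x : ℝ => step (n * x)) x‖
  set b := ‖iteratedDeriv (m - i) (fun x : ℝ => step (n * (1 - x))) x‖
  have ha : x ^ i * a ≤ C i := hC i n x hx0
  have hb : (1 - x) ^ (m - i) * b ≤ D (m - i) := hD (m - i) n x hx.2
  have ha0 : 0 ≤ a := norm_nonneg _
  have hb0 : 0 ≤ b := norm_nonneg _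
  have hle : (x * (1 - x)) ^ m ≤ x ^ i * (1 - x) ^ (m - i) := by
    rw [mul_pow]
    exact mul_le_mul (pow_le_pow_of_le_one hx0 hx.2 hi')
      (pow_le_pow_of_le_one hx1 (by linarith) (Nat.sub_le _ _)) (by positivity) (by positivity)
  calc (x * (1 - x)) ^ m * (m.choose i * a * b)
      ≤ (x ^ i * (1 - x) ^ (m - i)) * (m.choose i * a * b) :=
        mul_le_mul_of_nonneg_right hle (by positivity)
    _ = m.choose i * ((x ^ i * a) * ((1 - x) ^ (m - i) * b)) := by ring
    _ ≤ m.choose i * (C i * D (m - i)) :=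
        mul_le_mul_of_nonneg_left (mul_le_mul ha hb (by positivity) (hC0 i)) (by positivity)
    _ = _ := by ring

/-- If `ψ` vanishes to order `r` at both ends of `[0,1]`, the `r`-th derivatives of its cutoffs
stay bounded. -/
theorem exists_bound_cutoff_mul {r : ℕ} {ψ : ℝ → ℂ} (hψ : ContDiff ℝ ∞ ψ)
    (h0 : ∀ q < r, iteratedDeriv q ψ 0 = 0) (h1 : ∀ q < r, iteratedDeriv q ψ 1 = 0) :
    ∃ C, 0 ≤ C ∧ ∀ (n : ℕ), ∀ x ∈ Icc (0 : ℝ) 1,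
      ‖iteratedDeriv r (fun y => cutoff n y * ψ y) x‖ ≤ C := by
  choose C hC0 hC using exists_bound_cutoff
  -- The exponent `r - (r - i)` is `i` for the relevant `i ≤ r`; in this form the statement holds
  -- for all `i`, so that `choose` applies.
  have hψ' : ∀ i, ∃ D, 0 ≤ D ∧ ∀ x ∈ Icc (0 : ℝ) 1,
      ‖iteratedDeriv (r - i) ψ x‖ ≤ D * (x * (1 - x)) ^ (r - (r - i)) := fun i =>
    exists_norm_le_pow_two_sided (contDiff_iteratedDeriv hψ _)
      (fun q hq => by
        rw [iteratedDeriv_eq_iterate, iteratedDeriv_eq_iterate, ← Function.iterate_add_apply,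
          ← iteratedDeriv_eq_iterate]
        exact h0 _ (by omega))
      (fun q hq => by
        rw [iteratedDeriv_eq_iterate, iteratedDeriv_eq_iterate, ← Function.iterate_add_apply,
          ← iteratedDeriv_eq_iterate]
        exact h1 _ (by omega))
  choose D hD0 hD using hψ'
  refine ⟨∑ i ∈ Finset.range (r + 1), r.choose i * D i * C i,
    Finset.sum_nonneg fun i _ => mul_nonneg (mul_nonneg (by positivity) (hD0 i)) (hC0 _),
    fun n x hx => ?_⟩
  rw [iteratedDeriv_mul_leibniz (contDiff_cutoff n) hψ]
  refine (norm_sum_le _ _).trans (Finset.sum_le_sum fun i hi => ?_)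
  have hi' : i ≤ r := by simpa [Nat.lt_succ_iff] using hi
  rw [norm_mul, norm_mul, RCLike.norm_natCast]
  have h2 := hD i x hx
  rw [Nat.sub_sub_self hi'] at h2
  calc r.choose i * ‖iteratedDeriv i (cutoff n) x‖ * ‖iteratedDeriv (r - i) ψ x‖
      ≤ r.choose i * ‖iteratedDeriv i (cutoff n) x‖ * (D i * (x * (1 - x)) ^ i) :=
        mul_le_mul_of_nonneg_left h2 (by positivity)
    _ = r.choose i * D i * ((x * (1 - x)) ^ i * ‖iteratedDeriv i (cutoff n) x‖) := by ring
    _ ≤ _ := mul_le_mul_of_nonneg_left (hC i n x hx) (mul_nonneg (by positivity) (hD0 i))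

lemma cutoff_eventuallyEq_one {x : ℝ} (hx : x ∈ Ioo (0 : ℝ) 1) :
    ∀ᶠ n : ℕ in Filter.atTop, cutoff n =ᶠ[nhds x] fun _ => 1 := by
  obtain ⟨hx0, hx1⟩ := hx
  have hx1' : 0 < 1 - x := by linarith
  -- With `4` rather than `2`, both steps equal `1` on the neighbourhood `(x / 2, (1 + x) / 2)` and
  -- not only at `x`.
  filter_upwards [Filter.eventually_ge_atTop ⌈4 / x⌉₊, Filter.eventually_ge_atTop ⌈4 / (1 - x)⌉₊]
    with n hn1 hn2
  have hn1' : 4 ≤ n * x := (div_le_iff₀ hx0).1 (Nat.ceil_le.1 hn1)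
  have hn2' : 4 ≤ n * (1 - x) := (div_le_iff₀ hx1').1 (Nat.ceil_le.1 hn2)
  have hn0 : (0 : ℝ) ≤ n := Nat.cast_nonneg n
  filter_upwards [Ioo_mem_nhds (show x / 2 < x by linarith) (show x < (1 + x) / 2 by linarith)]
    with y hy
  rw [cutoff, step_eq_one (by nlinarith [hy.1]), step_eq_one (by nlinarith [hy.2]), one_mul]

lemma tendsto_iteratedDeriv_cutoff_mul (r : ℕ) (ψ : ℝ → ℂ) {x : ℝ} (hx : x ∈ Ioo (0 : ℝ) 1) :
    Filter.Tendsto (fun n => iteratedDeriv r (fun y => cutoff n y * ψ y) x) Filter.atTop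
      (nhds (iteratedDeriv r ψ x)) := by
  refine tendsto_const_nhds.congr' ?_
  filter_upwards [cutoff_eventuallyEq_one hx] with n hn
  refine Filter.EventuallyEq.iteratedDeriv_eq _ ?_
  filter_upwards [hn] with y hy
  rw [hy, one_mul]

lemma cutoff_eq_zero {n : ℕ} {x : ℝ} (hx : x ∉ Icc (1 / (n + 1) : ℝ) (1 - 1 / (n + 1))) :
    cutoff (n + 1) x = 0 := by
  have hn : (0 : ℝ) < n + 1 := by positivity
  rw [mem_Icc, not_and_or, not_le, not_le] at hx
  unfold cutoff
  push_cast
  rcases hx with h | h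
  · rw [step_eq_zero, zero_mul]
    rw [lt_div_iff₀ hn] at h; linarith
  · rw [step_eq_zero (y := (n + 1) * (1 - x)), mul_zero]
    have : 1 - x < 1 / (n + 1) := by linarith
    rw [lt_div_iff₀ hn] at this; linarith

/-! ### Weak derivatives tested against products -/

lemma iteratedFDeriv_apply_const {E : Type*} [NormedAddCommGroup E] [NormedSpace ℝ E] {φ : E → ℂ}
    (hφ : ContDiff ℝ ∞ φ) (r : ℕ) (x v : E) :
    iteratedFDeriv ℝ r φ x (fun _ => v) = iteratedDeriv r (fun t : ℝ => φ (x + t • v)) 0 := by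
  have h : (fun t : ℝ => φ (x + t • v)) =
      (fun z => φ (x + z)) ∘ (ContinuousLinearMap.toSpanSingleton ℝ v) := by
    ext t; simp [ContinuousLinearMap.toSpanSingleton_apply]
  have hs : ContDiff ℝ ∞ fun z => φ (x + z) := hφ.comp (contDiff_const.add contDiff_id)
  rw [iteratedDeriv_eq_iteratedFDeriv, h,
    ContinuousLinearMap.iteratedFDeriv_comp_right (n := ∞) _ hs 0 (i := r)
      (by exact_mod_cast le_top)]
  simp only [ContinuousMultilinearMap.compContinuousLinearMap_apply,
    ContinuousLinearMap.toSpanSingleton_apply, iteratedFDeriv_comp_add_left, zero_smul, one_smul,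
    add_zero]

lemma contDiff_prod_coord {u : Fin N → ℝ → ℂ} (hu : ∀ j, ContDiff ℝ ∞ (u j)) :
    ContDiff ℝ ∞ fun x : EuclideanSpace ℝ (Fin N) => ∏ j, u j (x j) :=
  contDiff_prod fun j _ => (hu j).comp
    (EuclideanSpace.proj j : EuclideanSpace ℝ (Fin N) →L[ℝ] ℝ).contDiff

/-- Along the line in direction `i` only the factor `u i` varies, so the pure derivative falls on
that factor alone. -/
lemma iteratedFDeriv_prod {u : Fin N → ℝ → ℂ} (hu : ∀ j, ContDiff ℝ ∞ (u j)) (r : ℕ) (i : Fin N)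
    (x : EuclideanSpace ℝ (Fin N)) :
    iteratedFDeriv ℝ r (fun x : EuclideanSpace ℝ (Fin N) => ∏ j, u j (x j)) x
      (fun _ => EuclideanSpace.single i (1 : ℝ)) =
      ∏ j, iteratedDeriv (Pi.single (M := fun _ => ℕ) i r j) (u j) (x j) := by
  rw [iteratedFDeriv_apply_const (contDiff_prod_coord hu)]
  have h : (fun t : ℝ => ∏ j, u j ((x + t • EuclideanSpace.single i (1 : ℝ)) j)) =
      fun t => (∏ j ∈ Finset.univ.erase i, u j (x j)) * u i (x i + t) := by
    ext t
    rw [← Finset.mul_prod_erase _ _ (Finset.mem_univ i), mul_comm]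
    congr 1
    · refine Finset.prod_congr rfl fun j hj => ?_
      simp [Finset.ne_of_mem_erase hj]
    · simp
  have hs : ContDiff ℝ ∞ fun t => u i (x i + t) := (hu i).comp (contDiff_const.add contDiff_id)
  rw [h, iteratedDeriv_const_mul _ (contDiffAt_natCast hs r 0), iteratedDeriv_comp_const_add,
    ← Finset.mul_prod_erase _ _ (Finset.mem_univ i), mul_comm]
  congr 1
  · simp
  · refine Finset.prod_congr rfl fun j hj => ?_
    simp [Finset.ne_of_mem_erase hj]

lemma integrable_ofReal_mul {α : Type*} {_ : MeasurableSpace α} {μ : Measure α} {f : α → ℝ}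
    (hf : Integrable f μ) {D : α → ℂ} (hD : AEStronglyMeasurable D μ) {C : ℝ}
    (hC : ∀ᵐ x ∂μ, ‖D x‖ ≤ C) : Integrable (fun x => (f x : ℂ) * D x) μ := by
  exact ((hf.ofReal (𝕜 := ℂ)).bdd_mul hD hC).congr
    (Filter.Eventually.of_forall fun x => mul_comm _ _)

/-- The definition of weak derivatives extends to complex valued test functions. -/
lemma IsWeakDeriv.integral_complex {Ω : Set (EuclideanSpace ℝ (Fin N))}
    {f g : EuclideanSpace ℝ (Fin N) → ℝ} {r : ℕ} {i : Fin r → Fin N} (h : IsWeakDeriv Ω i f g)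
    (hf : IntegrableOn f Ω) (hg : IntegrableOn g Ω) {φ : EuclideanSpace ℝ (Fin N) → ℂ}
    (hφ : ContDiff ℝ ∞ φ) (hc : HasCompactSupport φ) (hΩ : tsupport φ ⊆ Ω) :
    ∫ x in Ω, (f x : ℂ) * iteratedFDeriv ℝ r φ x (fun j => EuclideanSpace.single (i j) (1 : ℝ)) =
      (-1) ^ r * ∫ x in Ω, (g x : ℂ) * φ x := by
  have hDc : Continuous fun x =>
      iteratedFDeriv ℝ r φ x (fun j => EuclideanSpace.single (i j) (1 : ℝ)) :=
    (ContinuousMultilinearMap.apply ℝ (fun _ => EuclideanSpace ℝ (Fin N)) ℂ _).continuous.comp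
      (hφ.continuous_iteratedFDeriv (by exact_mod_cast le_top))
  have hDs : HasCompactSupport fun x =>
      iteratedFDeriv ℝ r φ x (fun j => EuclideanSpace.single (i j) (1 : ℝ)) :=
    (hc.iteratedFDeriv r).comp_left (g := fun T : ContinuousMultilinearMap ℝ
      (fun _ : Fin r => EuclideanSpace ℝ (Fin N)) ℂ =>
        T (fun j => EuclideanSpace.single (i j) (1 : ℝ))) rfl
  obtain ⟨C, hC⟩ := hDs.exists_bound_of_continuous hDc
  obtain ⟨C', hC'⟩ := hc.exists_bound_of_continuous hφ.continuous
  have i1 := integrable_ofReal_mul hf hDc.aestronglyMeasurable (Filter.Eventually.of_forall hC)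
  have i2 := integrable_ofReal_mul hg hφ.continuous.aestronglyMeasurable
    (Filter.Eventually.of_forall hC')
  -- A real functional commutes with integrals and derivatives, so the real definition applies to `L
  -- ∘ φ`; the real and imaginary parts then give the claim.
  have key : ∀ L : ℂ →L[ℝ] ℝ,
      L (∫ x in Ω, (f x : ℂ) * iteratedFDeriv ℝ r φ x
        (fun j => EuclideanSpace.single (i j) (1 : ℝ))) =
      L ((-1) ^ r * ∫ x in Ω, (g x : ℂ) * φ x) := by
    intro L
    have hL : ∀ (a : ℝ) (z : ℂ), L (a * z) = a * L z := by
      intro a z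
      rw [← Complex.real_smul, map_smul, smul_eq_mul]
    have e := h (fun x => L (φ x)) (L.contDiff.comp hφ) (hc.comp_left (map_zero L))
      ((tsupport_comp_subset (map_zero L) φ).trans hΩ)
    have hp : ∀ x, partialDeriv i (fun x => L (φ x)) x =
        L (iteratedFDeriv ℝ r φ x (fun j => EuclideanSpace.single (i j) (1 : ℝ))) := by
      intro x
      unfold partialDeriv
      have := L.iteratedFDeriv_comp_left (f := φ) (x := x) (i := r) hφ.contDiffAt
        (by exact_mod_cast le_top)
      change iteratedFDeriv ℝ r (L ∘ φ) x _ = _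
      rw [this]
      rfl
    have hpow : ((-1 : ℂ) ^ r) = (((-1 : ℝ) ^ r : ℝ) : ℂ) := by push_cast; rfl
    rw [hpow, hL, ← L.integral_comp_comm i1, ← L.integral_comp_comm i2]
    simp only [hL]
    rw [← e]
    simp only [hp]
  exact Complex.ext (key Complex.reCLM) (key Complex.imCLM)

lemma isCompact_box {A : Set ℝ} (hA : IsCompact A) : IsCompact (box N A) := by
  have h := (isCompact_univ_pi fun _ : Fin N => hA).image
    (PiLp.continuous_toLp 2 (fun _ : Fin N => ℝ))
  convert h
  ext x
  constructor
  · exact fun hx => ⟨fun j => x j, fun j _ => hx j, by ext; rfl⟩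
  · rintro ⟨y, hy, rfl⟩ j
    exact hy j (mem_univ j)

/-- Integration by parts against a product of functions of one variable: in the variable that is
differentiated the test function has to vanish to order `r` at the faces of the cube, in the others
no boundary condition is needed. -/
theorem IsWeakDeriv.integral_prod {f g : EuclideanSpace ℝ (Fin N) → ℝ} {r : ℕ} {i : Fin N}
    (h : IsWeakDeriv (openCube N) (fun _ : Fin r => i) f g)
    (hf : IntegrableOn f (openCube N)) (hg : IntegrableOn g (openCube N)) {ψ : Fin N → ℝ → ℂ}
    (hψ : ∀ j, ContDiff ℝ ∞ (ψ j)) (h0 : ∀ q < r, iteratedDeriv q (ψ i) 0 = 0)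
    (h1 : ∀ q < r, iteratedDeriv q (ψ i) 1 = 0) :
    ∫ x in openCube N, (f x : ℂ) *
        ∏ j, iteratedDeriv (Pi.single (M := fun _ => ℕ) i r j) (ψ j) (x j) =
      (-1) ^ r * ∫ x in openCube N, (g x : ℂ) * ∏ j, ψ j (x j) := by
  have hs : ∀ n j, ContDiff ℝ ∞ fun y => cutoff n y * ψ j y := fun n j =>
    (contDiff_cutoff n).mul (hψ j)
  have hO : MeasurableSet (openCube N) := measurableSet_box measurableSet_Ioo
  -- Dominated convergence as the cutoffs tend to `1`. It is used for `f` with one derivative order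
  -- `r` in direction `i`, and for `g` with no derivatives, where the vanishing conditions are
  -- empty.
  have hlim : ∀ {F : EuclideanSpace ℝ (Fin N) → ℝ} (q : Fin N → ℕ), IntegrableOn F (openCube N) →
      (∀ j, ∀ p < q j, iteratedDeriv p (ψ j) 0 = 0) →
      (∀ j, ∀ p < q j, iteratedDeriv p (ψ j) 1 = 0) →
      Filter.Tendsto (fun n : ℕ => ∫ x in openCube N, (F x : ℂ) *
        ∏ j, iteratedDeriv (q j) (fun y => cutoff (n + 1) y * ψ j y) (x j)) Filter.atTop
        (nhds (∫ x in openCube N, (F x : ℂ) * ∏ j, iteratedDeriv (q j) (ψ j) (x j))) := by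
    intro F q hF hq0 hq1
    choose C hC0 hC using fun j => exists_bound_cutoff_mul (hψ j) (hq0 j) (hq1 j)
    have hmeas : ∀ n, Continuous fun x : EuclideanSpace ℝ (Fin N) =>
        ∏ j, iteratedDeriv (q j) (fun y => cutoff (n + 1) y * ψ j y) (x j) := fun n =>
      continuous_finsetProd _ fun j _ =>
        (continuous_iteratedDeriv' (hs (n + 1) j) (q j)).comp (by fun_prop)
    refine tendsto_integral_of_dominated_convergence (fun x => ‖F x‖ * ∏ j, C j) (fun n => ?_)
      (hF.norm.mul_const _) (fun n => ?_) ?_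
    · exact (hF.ofReal (𝕜 := ℂ)).aestronglyMeasurable.mul (hmeas n).aestronglyMeasurable
    · filter_upwards [ae_restrict_mem hO] with x hx
      rw [norm_mul, norm_prod, Complex.norm_real]
      exact mul_le_mul_of_nonneg_left (Finset.prod_le_prod (fun _ _ => norm_nonneg _)
        fun j _ => hC j _ _ (Ioo_subset_Icc_self (hx j))) (norm_nonneg _)
    · filter_upwards [ae_restrict_mem hO] with x hx
      refine tendsto_const_nhds.mul (tendsto_finsetProd _ fun j _ => ?_)
      exact (tendsto_iteratedDeriv_cutoff_mul (q j) (ψ j) (hx j)).comp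
        (Filter.tendsto_add_atTop_nat 1)
  have hl1 := hlim (F := f) (Pi.single i r) hf
    (fun j p hp => by
      rcases eq_or_ne j i with rfl | hj
      · exact h0 p (by simpa using hp)
      · simp [hj] at hp)
    (fun j p hp => by
      rcases eq_or_ne j i with rfl | hj
      · exact h1 p (by simpa using hp)
      · simp [hj] at hp)
  have hl2 := hlim (F := g) 0 hg (by simp) (by simp)
  simp only [Pi.zero_apply, iteratedDeriv_zero] at hl2
  refine tendsto_nhds_unique hl1 ((hl2.const_mul ((-1 : ℂ) ^ r)).congr fun n => ?_)
  set K : Set (EuclideanSpace ℝ (Fin N)) := box N (Icc (1 / (n + 1) : ℝ) (1 - 1 / (n + 1)))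
  have hK : IsCompact K := isCompact_box isCompact_Icc
  have hK0 : ∀ x ∉ K, ∏ j, cutoff (n + 1) (x j) * ψ j (x j) = 0 := by
    intro x hx
    obtain ⟨j, hj⟩ := not_forall.1 hx
    exact Finset.prod_eq_zero (Finset.mem_univ j) (by rw [cutoff_eq_zero hj, zero_mul])
  have hKO : K ⊆ openCube N := fun x hx j => by
    have hn : (0 : ℝ) < 1 / (n + 1) := by positivity
    exact ⟨hn.trans_le (hx j).1, (hx j).2.trans_lt (by linarith)⟩
  have := h.integral_complex hf hg (contDiff_prod_coord (hs (n + 1)))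
    (HasCompactSupport.intro hK hK0)
    ((closure_minimal (Function.support_subset_iff'.2 hK0) hK.isClosed).trans hKO)
  simp only [iteratedFDeriv_prod (hs (n + 1))] at this
  exact this.symm

/-! ### The dual of an extension operator by reflections -/

lemma iteratedDeriv_char (n : ℤ) (q : ℕ) (x : ℝ) :
    iteratedDeriv q (char n) x = (Real.pi * Complex.I * n) ^ q * char n x := by
  induction q generalizing x with
  | zero => simp
  | succ q ih =>
    rw [iteratedDeriv_succ, funext ih]
    have h : HasDerivAt (char n) (char n x * (Real.pi * Complex.I * n)) x := by
      have h1 : HasDerivAt (fun y : ℝ => (Real.pi * Complex.I * n) * (y : ℂ))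
          ((Real.pi * Complex.I * n) * 1) x := (Complex.ofRealCLM.hasDerivAt (x := x)).const_mul _
      have h2 := h1.cexp
      rw [mul_one] at h2
      exact h2
    rw [(h.const_mul _).deriv]
    ring

/-- The factors by which the frequency is multiplied under the reflections used. -/
def freq {l : ℕ} : Option (Fin l) → ℤ
  | none => -1
  | some s => 2 * s + 1

lemma freq_ne_zero {l : ℕ} (s : Option (Fin l)) : freq s ≠ 0 := by
  cases s with
  | none => simp [freq]
  | some s => simp only [freq]; omega

/-- The combination of characters with coefficients `α` and frequencies `freq s * n`. -/
def wave {l : ℕ} (α : Option (Fin l) → ℝ → ℂ) (n : ℤ) (x : ℝ) : ℂ :=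
  ∑ s, α s x * char (freq s * n) x

lemma contDiff_wave {l : ℕ} {α : Option (Fin l) → ℝ → ℂ} (hα : ∀ s, ContDiff ℝ ∞ (α s)) (n : ℤ) :
    ContDiff ℝ ∞ (wave α n) :=
  ContDiff.sum fun s _ => (hα s).mul (contDiff_char _)

/-- Weights of a reflection that matches derivatives of order less than `l`. -/
lemma exists_weights (l : ℕ) : ∃ b : Fin l → ℂ, ∀ m < l,
    ∑ s, b s * (-(2 * (s : ℕ) + 1 : ℂ)) ^ m = -1 := by
  let v : Fin l → ℂ := fun s => -(2 * (s : ℕ) + 1 : ℂ)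
  have hv : Set.InjOn v (Finset.univ : Finset (Fin l)) := by
    intro s _ t _ h
    have h' : (2 * ((s : ℕ) : ℂ) + 1) = 2 * ((t : ℕ) : ℂ) + 1 := neg_injective h
    exact Fin.ext (by exact_mod_cast (mul_left_cancel₀ two_ne_zero (add_right_cancel h')))
  -- Lagrange extrapolation from the nodes `v s = -(2 s + 1)` to the point `1` is exact on `X ^ m`
  -- for `m < l`; the sign turns the value `1` into `-1`.
  refine ⟨fun s => -(Lagrange.basis Finset.univ v s).eval 1, fun m hm => ?_⟩
  have h := Lagrange.eq_interpolate (f := (Polynomial.X : Polynomial ℂ) ^ m) hv (by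
    rw [Polynomial.degree_X_pow, Finset.card_univ, Fintype.card_fin]; exact_mod_cast hm)
  have h1 := congrArg (Polynomial.eval 1) h
  simp only [Lagrange.interpolate_apply, Polynomial.eval_finsetSum, Polynomial.eval_mul,
    Polynomial.eval_C, Polynomial.eval_pow, Polynomial.eval_X, one_pow] at h1
  refine Eq.trans ?_ (congrArg Neg.neg h1.symm)
  rw [← Finset.sum_neg_distrib]
  exact Finset.sum_congr rfl fun s _ => by simp only [v]; ring

/-- A smooth function that is `1` near `0` and near `1` and vanishes on `[δ, 1 - δ]`. -/
lemma exists_endpoint_cutoff {δ : ℝ} (hδ : 0 < δ) (hδ' : δ ≤ 1 / 2) : ∃ κ : ℝ → ℂ,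
    ContDiff ℝ ∞ κ ∧ κ =ᶠ[nhds 0] (fun _ => 1) ∧ κ =ᶠ[nhds 1] (fun _ => 1) ∧
      ∀ x ∈ Icc δ (1 - δ), κ x = 0 := by
  have hone : ∀ x, x ≤ δ / 2 → step (3 - 2 / δ * x) = 1 := fun x hx => step_eq_one (by
    have : 2 / δ * x ≤ 2 / δ * (δ / 2) := mul_le_mul_of_nonneg_left hx (by positivity)
    rw [show 2 / δ * (δ / 2) = 1 by field_simp] at this
    linarith)
  have hzero : ∀ x, δ ≤ x → step (3 - 2 / δ * x) = 0 := fun x hx => step_eq_zero (by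
    have : 2 / δ * δ ≤ 2 / δ * x := mul_le_mul_of_nonneg_left hx (by positivity)
    rw [show 2 / δ * δ = 2 by field_simp] at this
    linarith)
  refine ⟨fun x => step (3 - 2 / δ * x) + step (3 - 2 / δ * (1 - x)), ?_, ?_, ?_, ?_⟩
  · exact (contDiff_step.comp (contDiff_const.sub (contDiff_const.mul contDiff_id))).add
      (contDiff_step.comp (contDiff_const.sub (contDiff_const.mul
        (contDiff_const.sub contDiff_id))))
  · filter_upwards [gt_mem_nhds (show 0 < δ / 2 by linarith)] with x hx
    rw [hone x hx.le, hzero (1 - x) (by linarith), add_zero]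
  · filter_upwards [lt_mem_nhds (show 1 - δ / 2 < 1 by linarith)] with x hx
    rw [hzero x (by linarith), hone (1 - x) (by linarith), zero_add]
  · intro x hx
    beta_reduce
    rw [hzero x hx.1, hzero (1 - x) (by linarith [hx.2]), zero_add]

/-- Coefficients `α` such that `wave α` arises from the characters of period `2` by the dual of an
extension operator (last property), while multiplication of `wave α n` by `(-π i n)^l` amounts to
differentiating functions that vanish at the end points. -/
theorem exists_reflection (l : ℕ) : ∃ (α : Option (Fin l) → ℝ → ℂ)
    (β : ℕ → Option (Fin l) → ℝ → ℂ),
    (∀ s, ContDiff ℝ ∞ (α s)) ∧ (∀ m s, ContDiff ℝ ∞ (β m s)) ∧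
    (∀ n x, (-(Real.pi * Complex.I * n)) ^ l * wave α n x =
      ∑ m ∈ Finset.range (l + 1), iteratedDeriv (l - m) (wave (β m) n) x) ∧
    (∀ m n, ∀ q < l - m, iteratedDeriv q (wave (β m) n) 0 = 0 ∧
      iteratedDeriv q (wave (β m) n) 1 = 0) ∧
    ∀ P : ℝ → ℂ, Function.Periodic P 2 → (∀ y ∈ Icc (-1 : ℝ) 0, P y = 0) → ∀ x ∈ Ioo (0 : ℝ) 1,
      ∑ s, α s x * P (-(freq s * x)) = 2⁻¹ * P x := by
  obtain ⟨b, hb⟩ := exists_weights l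
  obtain ⟨c, hc0, hc⟩ := exists_inverse_leibniz l
  -- The collar width is chosen so that `(2 s + 1) x < 1` for `s < l` and `x` in the collar at `0`:
  -- its reflected images stay inside `(-1, 0)`.
  obtain ⟨κ, hκ, hκ0, hκ1, hκz⟩ := exists_endpoint_cutoff (δ := 1 / (2 * l + 2)) (by positivity)
    (by rw [div_le_div_iff₀ (by positivity) (by positivity)]; linarith [Nat.cast_nonneg (α := ℝ) l])
  let v : Fin l → ℂ := fun s => -(2 * (s : ℕ) + 1 : ℂ)
  -- Up to sign, `Q n` agrees with `char (-n)` to order `l` at both end points, so `char (-n) + κ *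
  -- Q n` vanishes there to that order.
  let Q : ℤ → ℝ → ℂ := fun n x => ∑ s, b s * char (freq (some s) * n) x
  have hQ : ∀ n, ContDiff ℝ ∞ (Q n) := fun n =>
    ContDiff.sum fun s _ => contDiff_const.mul (contDiff_char _)
  have hDQ : ∀ n q x, iteratedDeriv q (Q n) x = (-(Real.pi * Complex.I * n)) ^ q *
      ∑ s, b s * v s ^ q * char (freq (some s) * n) x := by
    intro n q x
    rw [iteratedDeriv_fun_sum fun s _ =>
      (contDiffAt_natCast (contDiff_const.mul (contDiff_char _)) q x), Finset.mul_sum]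
    refine Finset.sum_congr rfl fun s _ => ?_
    rw [iteratedDeriv_const_mul _ (contDiffAt_natCast (contDiff_char _) q x), iteratedDeriv_char,
      show (Real.pi * Complex.I * (freq (some s) * n : ℤ) : ℂ) =
        -(Real.pi * Complex.I * n) * v s by simp only [freq, v]; push_cast; ring, mul_pow]
    ring
  -- The factor `v s ^ l` makes `(-π i n)^l * wave α n` equal to half of `D^l (char (-n)) + κ * D^l
  -- (Q n)`. The inverse Leibniz rule then expands the last term, which gives `β`.
  let α : Option (Fin l) → ℝ → ℂ := fun s x => match s with
    | none => 2⁻¹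
    | some s => 2⁻¹ * (b s * v s ^ l) * κ x
  let β : ℕ → Option (Fin l) → ℝ → ℂ := fun m s x => match s with
    | none => if m = 0 then 2⁻¹ else 0
    | some s => 2⁻¹ * c m * b s * iteratedDeriv m κ x
  have hα : ∀ s, ContDiff ℝ ∞ (α s) := by
    rintro (_ | s)
    · exact contDiff_const
    · exact contDiff_const.mul hκ
  have hβ : ∀ m s, ContDiff ℝ ∞ (β m s) := by
    rintro m (_ | s)
    · exact contDiff_const
    · exact contDiff_const.mul (contDiff_iteratedDeriv hκ m)
  have hwβ : ∀ m n, wave (β m) n = fun x => (if m = 0 then 2⁻¹ else 0) * char (-n) x +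
      2⁻¹ * c m * (iteratedDeriv m κ x * Q n x) := by
    intro m n
    ext x
    simp only [wave, Fintype.sum_option, β, freq, neg_one_mul, Q]
    rw [Finset.mul_sum, Finset.mul_sum]
    congr 1
    exact Finset.sum_congr rfl fun s _ => by ring
  -- Near an end point `κ = 1`: the terms with `m > 0` vanish identically there, and for `m = 0` the
  -- weights `b` cancel the derivatives of `char (-n)`.
  have hvan : ∀ m n q x, q < l - m → κ =ᶠ[nhds x] (fun _ => 1) →
      (∀ s : Fin l, char (freq (some s) * n) x = char (-n) x) →
      iteratedDeriv q (wave (β m) n) x = 0 := by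
    intro m n q x hq hκx hch
    rw [hwβ]
    rcases Nat.eq_zero_or_pos m with rfl | hm
    · have he : (fun x => (if (0 : ℕ) = 0 then (2⁻¹ : ℂ) else 0) * char (-n) x +
          2⁻¹ * c 0 * (iteratedDeriv 0 κ x * Q n x)) =ᶠ[nhds x]
          fun x => 2⁻¹ * (char (-n) x + Q n x) := by
        filter_upwards [hκx] with y hy
        simp only [if_true, hc0, iteratedDeriv_zero, hy]; ring
      rw [he.iteratedDeriv_eq, iteratedDeriv_const_mul _
        (contDiffAt_natCast ((contDiff_char _).add (hQ n)) q x),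
        iteratedDeriv_fun_add (contDiffAt_natCast (contDiff_char _) q x)
          (contDiffAt_natCast (hQ n) q x), iteratedDeriv_char, hDQ]
      simp only [hch]
      rw [← Finset.sum_mul, hb q (by omega)]
      push_cast
      ring
    · have he : (fun x => (if m = 0 then (2⁻¹ : ℂ) else 0) * char (-n) x +
          2⁻¹ * c m * (iteratedDeriv m κ x * Q n x)) =ᶠ[nhds x] fun _ => 0 := by
        filter_upwards [hκx.eventuallyEq_nhds] with y hy
        rw [hy.iteratedDeriv_eq, iteratedDeriv_const, if_neg hm.ne', if_neg hm.ne']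
        ring
      rw [he.iteratedDeriv_eq, iteratedDeriv_const]
      simp
  refine ⟨α, β, hα, hβ, fun n x => ?_, fun m n q hq => ⟨?_, ?_⟩, fun P hP hP0 x hx => ?_⟩
  · have h1 : ∀ m ∈ Finset.range (l + 1), iteratedDeriv (l - m) (wave (β m) n) x =
        (if m = 0 then 2⁻¹ * ((-(Real.pi * Complex.I * n)) ^ l * char (-n) x) else 0) +
          2⁻¹ * (c m * iteratedDeriv (l - m) (fun y => iteratedDeriv m κ y * Q n y) x) := by
      intro m _
      have hs := (contDiff_iteratedDeriv hκ m).mul (hQ n)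
      rw [hwβ, iteratedDeriv_fun_add
        (contDiffAt_natCast (contDiff_const.mul (contDiff_char _)) _ x)
        (contDiffAt_natCast (contDiff_const.mul hs) _ x),
        iteratedDeriv_const_mul _ (contDiffAt_natCast (contDiff_char _) _ x),
        iteratedDeriv_const_mul _ (contDiffAt_natCast hs _ x), iteratedDeriv_char]
      split_ifs with hm
      · subst hm; push_cast; rw [Nat.sub_zero]; ring
      · ring
    rw [Finset.sum_congr rfl h1, Finset.sum_add_distrib, ← Finset.mul_sum, ← hc κ (Q n) hκ (hQ n),
      hDQ, Finset.sum_ite_eq' , if_pos (by simp)]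
    simp only [wave, Fintype.sum_option, α, freq, neg_one_mul]
    simp only [mul_add, Finset.mul_sum]
    congr 1
    · ring
    · exact Finset.sum_congr rfl fun s _ => by ring
  · exact hvan m n q 0 hq hκ0 fun s => by rw [char_zero_right, char_zero_right]
  · refine hvan m n q 1 hq hκ1 fun s => ?_
    -- The frequencies `(2 s + 1) n` and `-n` differ by an even integer, so the dilations by odd
    -- factors centred at `0` act modulo `2` as reflections at `1` too.
    have h2 : char (freq (some s) * n + n) 1 = 1 := by
      have := char_two_mul 1 ((s + 1) * n)
      rw [← this]
      simp only [char, freq]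
      congr 1
      push_cast
      ring
    have h3 : char (freq (some s) * n) 1 = char (-n) 1 * char (freq (some s) * n + n) 1 := by
      rw [char_mul_char]; congr 1; ring
    rw [h3, h2, mul_one]
  · have hz : ∀ s : Fin l, κ x * P (-(freq (some s) * x)) = 0 := by
      intro s
      have hs : (s : ℝ) + 1 ≤ l := by exact_mod_cast s.2
      have hs0 : (0 : ℝ) ≤ s := Nat.cast_nonneg _
      have hl : (0 : ℝ) < 2 * l + 2 := by positivity
      by_cases hxδ : x ∈ Icc (1 / (2 * l + 2) : ℝ) (1 - 1 / (2 * l + 2))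
      · rw [hκz x hxδ, zero_mul]
      · rw [mem_Icc, not_and_or, not_le, not_le] at hxδ
        have : P (-(freq (some s) * x)) = 0 := by
          simp only [freq]
          push_cast
          rcases hxδ with h | h
          · rw [lt_div_iff₀ hl] at h
            exact hP0 _ ⟨by nlinarith [hx.1], by nlinarith [hx.1]⟩
          · have h' : 1 - x < 1 / (2 * l + 2) := by linarith
            rw [lt_div_iff₀ hl] at h'
            -- Shifting by the period, the argument becomes `-1 + (2 s + 1) (1 - x)`, which lies in
            -- `[-1, 0]` near the right end.
            rw [← hP.nat_mul s]
            exact hP0 _ ⟨by nlinarith [hx.2], by nlinarith [hx.2]⟩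
        rw [this, mul_zero]
    simp only [Fintype.sum_option, α]
    rw [Finset.sum_eq_zero fun s _ => by rw [mul_assoc, hz, mul_zero]]
    simp [freq]

/-! ### Square summability of the coefficients -/

lemma summable_sq_sum {ι κ : Type*} (s : Finset κ) {a : κ → ι → ℂ}
    (h : ∀ m ∈ s, Summable fun i => ‖a m i‖ ^ 2) : Summable fun i => ‖∑ m ∈ s, a m i‖ ^ 2 := by
  refine Summable.of_nonneg_of_le (fun i => by positivity) (fun i => ?_)
    ((summable_sum h).mul_left (s.card : ℝ))
  exact (pow_le_pow_left₀ (norm_nonneg _) (norm_sum_le _ _) 2).trans sq_sum_le_card_mul_sum_sq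

lemma exists_bound_on_Icc {a : ℝ → ℂ} (ha : Continuous a) :
    ∃ C, 0 ≤ C ∧ ∀ x ∈ Ioo (0 : ℝ) 1, ‖a x‖ ≤ C := by
  obtain ⟨C, hC⟩ := isCompact_Icc.exists_bound_of_continuousOn (ha.continuousOn (s := Icc (0 : ℝ) 1))
  exact ⟨C, (norm_nonneg _).trans (hC 0 (by simp)), fun x hx => hC x (Ioo_subset_Icc_self hx)⟩

lemma exists_bound_prod {a : Fin N → ℝ → ℂ} (ha : ∀ j, Continuous (a j)) :
    ∃ C, 0 ≤ C ∧ ∀ x ∈ openCube N, ‖∏ j, a j (x j)‖ ≤ C := by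
  choose C hC0 hC using fun j => exists_bound_on_Icc (ha j)
  refine ⟨∏ j, C j, Finset.prod_nonneg fun j _ => hC0 j, fun x hx => ?_⟩
  rw [norm_prod]
  exact Finset.prod_le_prod (fun _ _ => norm_nonneg _) fun j _ => hC j _ (hx j)

lemma continuous_prod_coord {a : Fin N → ℝ → ℂ} (ha : ∀ j, Continuous (a j)) :
    Continuous fun x : EuclideanSpace ℝ (Fin N) => ∏ j, a j (x j) :=
  continuous_finsetProd _ fun j _ => (ha j).comp (by fun_prop)

lemma isFiniteMeasure_openCube : IsFiniteMeasure
    (volume.restrict (openCube N) : Measure (EuclideanSpace ℝ (Fin N))) :=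
  ⟨by rw [Measure.restrict_apply_univ]; exact volume_box_lt_top measurableSet_Ioo (by simp)⟩

lemma measurableSet_openCube : MeasurableSet (openCube N) := measurableSet_box measurableSet_Ioo

lemma integrable_mul_prod {F : EuclideanSpace ℝ (Fin N) → ℝ} (hF : IntegrableOn F (openCube N))
    {a : Fin N → ℝ → ℂ} (ha : ∀ j, Continuous (a j)) :
    Integrable (fun x => (F x : ℂ) * ∏ j, a j (x j)) (volume.restrict (openCube N)) := by
  obtain ⟨C, _, hC⟩ := exists_bound_prod ha
  refine integrable_ofReal_mul hF (continuous_prod_coord ha).aestronglyMeasurable (C := C) ?_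
  filter_upwards [ae_restrict_mem measurableSet_openCube] with x hx using hC x hx

/-- Extension of `F * ∏ a j` by zero to the period cell reduces this to Bessel's inequality, sampled
along the injection `k ↦ (p j * k j)`; this is why no `p j` may vanish. -/
lemma summable_sq_char {F : EuclideanSpace ℝ (Fin N) → ℝ}
    (hF : MemLp F 2 (volume.restrict (openCube N))) {a : Fin N → ℝ → ℂ}
    (ha : ∀ j, Continuous (a j)) {p : Fin N → ℤ} (hp : ∀ j, p j ≠ 0) :
    Summable fun k : Fin N → ℤ =>
      ‖∫ x in openCube N, (F x : ℂ) * ∏ j, (a j (x j) * char (p j * k j) (x j))‖ ^ 2 := by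
  have hO := measurableSet_openCube (N := N)
  have hsub : openCube N ⊆ box N (Ioo (-1) 1) := fun x hx j =>
    ⟨by linarith [(hx j).1], (hx j).2⟩
  obtain ⟨A, hA⟩ : ∃ A : EuclideanSpace ℝ (Fin N) → ℂ, A = fun x => ∏ j, a j (x j) := ⟨_, rfl⟩
  obtain ⟨C, hC0, hC⟩ := exists_bound_prod ha
  have hAc : Continuous A := hA ▸ continuous_prod_coord ha
  have hGm : MemLp (fun x => (F x : ℂ) * A x) 2 (volume.restrict (openCube N)) := by
    refine MemLp.of_le_mul (c := C) hF
      ((Complex.continuous_ofReal.comp_aestronglyMeasurable hF.1).mul hAc.aestronglyMeasurable) ?_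
    filter_upwards [ae_restrict_mem hO] with x hx
    rw [norm_mul, Complex.norm_real, mul_comm, hA]
    exact mul_le_mul_of_nonneg_right (hC x hx) (norm_nonneg _)
  have hind : MemLp ((openCube N).indicator fun x => (F x : ℂ) * A x) 2
      (volume.restrict (box N (Ioo (-1) 1))) := by
    rw [memLp_indicator_iff_restrict hO, Measure.restrict_restrict hO,
      inter_eq_self_of_subset_left hsub]
    exact hGm
  have hinj : Function.Injective fun (k : Fin N → ℤ) j => p j * k j := fun k k' h =>
    funext fun j => mul_left_cancel₀ (hp j) (congrFun h j)
  refine ((summable_sq_fourier hind).comp_injective hinj).congr fun k => ?_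
  have h1 : (fun x => charN (fun j => p j * k j) x *
      (openCube N).indicator (fun x => (F x : ℂ) * A x) x) =
      (openCube N).indicator fun x => charN (fun j => p j * k j) x * (F x * A x) := by
    ext x
    by_cases hx : x ∈ openCube N
    · rw [indicator_of_mem hx, indicator_of_mem hx]
    · rw [indicator_of_notMem hx, indicator_of_notMem hx, mul_zero]
  have h2 : ∀ x : EuclideanSpace ℝ (Fin N), charN (fun j => p j * k j) x * (F x * A x) =
      (F x : ℂ) * ∏ j, (a j (x j) * char (p j * k j) (x j)) := by
    intro x
    rw [Finset.prod_mul_distrib, hA, charN]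
    ring
  rw [Function.comp_apply, h1, setIntegral_indicator hO, inter_eq_self_of_subset_right hsub]
  simp only [h2]

/-- Bessel's inequality for products of waves. -/
theorem summable_sq_wave {l : ℕ} {F : EuclideanSpace ℝ (Fin N) → ℝ}
    (hF : MemLp F 2 (volume.restrict (openCube N))) {a : Fin N → Option (Fin l) → ℝ → ℂ}
    (ha : ∀ j s, Continuous (a j s)) :
    Summable fun k : Fin N → ℤ =>
      ‖∫ x in openCube N, (F x : ℂ) * ∏ j, wave (a j) (k j) (x j)‖ ^ 2 := by
  have := isFiniteMeasure_openCube (N := N)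
  have hFi : IntegrableOn F (openCube N) := hF.integrable one_le_two
  refine (summable_sq_sum (Finset.univ : Finset (Fin N → Option (Fin l))) fun σ _ =>
    summable_sq_char hF (fun j => ha j (σ j)) fun j => freq_ne_zero (σ j)).congr fun k => ?_
  have hi : ∀ σ ∈ (Finset.univ : Finset (Fin N → Option (Fin l))),
      Integrable (fun x : EuclideanSpace ℝ (Fin N) => (F x : ℂ) *
        ∏ j, (a j (σ j) (x j) * char (freq (σ j) * k j) (x j)))
        (volume.restrict (openCube N)) := fun σ _ =>
    integrable_mul_prod (a := fun j y => a j (σ j) y * char (freq (σ j) * k j) y) hFi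
      fun j => (ha j (σ j)).mul (continuous_char _)
  have he : ∀ x : EuclideanSpace ℝ (Fin N), ∑ σ : Fin N → Option (Fin l), (F x : ℂ) *
      ∏ j, (a j (σ j) (x j) * char (freq (σ j) * k j) (x j)) =
      (F x : ℂ) * ∏ j, wave (a j) (k j) (x j) := by
    intro x
    simp only [wave]
    rw [Finset.prod_univ_sum, Fintype.piFinset_univ, Finset.mul_sum]
  rw [← integral_finsetSum _ hi]
  simp only [he]

/-- The Fourier coefficients of the extension of `f` whose dual is given by `α`. -/
def coeff {l : ℕ} (f : EuclideanSpace ℝ (Fin N) → ℝ) (α : Option (Fin l) → ℝ → ℂ)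
    (k : Fin N → ℤ) : ℂ :=
  ∫ x in openCube N, (f x : ℂ) * ∏ j, wave α (k j) (x j)

lemma summable_sq_coeff {l : ℕ} {f : EuclideanSpace ℝ (Fin N) → ℝ}
    (hf : MemLp f 2 (volume.restrict (openCube N))) {α : Option (Fin l) → ℝ → ℂ}
    (hα : ∀ s, ContDiff ℝ ∞ (α s)) : Summable fun k : Fin N → ℤ => ‖coeff f α k‖ ^ 2 :=
  summable_sq_wave hf (a := fun _ => α) fun _ s => (hα s).continuous

/-- Moving `(-π i (k i))^l` onto the wave in variable `i` turns it into derivatives of functions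
with vanishing boundary data. These pass to `f`, leaving waves integrated against its weak
derivatives, to which Bessel's inequality applies. Only pure derivatives in direction `i` occur. -/
lemma summable_sq_pow_mul_coeff {l : ℕ} {f : EuclideanSpace ℝ (Fin N) → ℝ}
    (hf : MemSobolev l (openCube N) f) {α : Option (Fin l) → ℝ → ℂ}
    {β : ℕ → Option (Fin l) → ℝ → ℂ} (hα : ∀ s, ContDiff ℝ ∞ (α s))
    (hβ : ∀ m s, ContDiff ℝ ∞ (β m s))
    (hαβ : ∀ n x, (-(Real.pi * Complex.I * n)) ^ l * wave α n x =
      ∑ m ∈ Finset.range (l + 1), iteratedDeriv (l - m) (wave (β m) n) x)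
    (hvan : ∀ m n, ∀ q < l - m, iteratedDeriv q (wave (β m) n) 0 = 0 ∧
      iteratedDeriv q (wave (β m) n) 1 = 0) (i : Fin N) :
    Summable fun k : Fin N → ℤ => ‖((k i : ℂ)) ^ l * coeff f α k‖ ^ 2 := by
  have := isFiniteMeasure_openCube (N := N)
  have hfi : IntegrableOn f (openCube N) := hf.1.integrable one_le_two
  choose g hg hgw using fun m : ℕ => hf.2 (l - m) (Nat.sub_le l m) fun _ => i
  have hgi : ∀ m, IntegrableOn (g m) (openCube N) := fun m => (hg m).integrable one_le_two
  -- The coefficients change to `β m` in variable `i` only; the other variables keep `α`.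
  let a : ℕ → Fin N → Option (Fin l) → ℝ → ℂ := fun m => Function.update (fun _ => α) i (β m)
  have ha : ∀ m j s, ContDiff ℝ ∞ (a m j s) := by
    intro m j s
    rcases eq_or_ne j i with rfl | hj
    · simp only [a, Function.update_self]; exact hβ m s
    · simp only [a, Function.update_of_ne hj]; exact hα s
  have hw : ∀ m j n, ContDiff ℝ ∞ (wave (a m j) n) := fun m j n => contDiff_wave (ha m j) n
  have key : ∀ k : Fin N → ℤ, (-(Real.pi * Complex.I * k i)) ^ l * coeff f α k =
      ∑ m ∈ Finset.range (l + 1), (-1 : ℂ) ^ (l - m) *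
        ∫ x in openCube N, (g m x : ℂ) * ∏ j, wave (a m j) (k j) (x j) := by
    intro k
    have h1 : ∀ m, (-1 : ℂ) ^ (l - m) *
        ∫ x in openCube N, (g m x : ℂ) * ∏ j, wave (a m j) (k j) (x j) =
        ∫ x in openCube N, (f x : ℂ) * ∏ j, iteratedDeriv (Pi.single (M := fun _ => ℕ) i (l - m) j)
          (wave (a m j) (k j)) (x j) := by
      intro m
      refine ((hgw m).integral_prod hfi (hgi m) (ψ := fun j => wave (a m j) (k j))
        (fun j => hw m j (k j)) ?_ ?_).symm
      · simp only [a, Function.update_self]; exact fun q hq => (hvan m _ q hq).1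
      · simp only [a, Function.update_self]; exact fun q hq => (hvan m _ q hq).2
    have hi : ∀ m ∈ Finset.range (l + 1), Integrable (fun x : EuclideanSpace ℝ (Fin N) =>
        (f x : ℂ) * ∏ j, iteratedDeriv (Pi.single (M := fun _ => ℕ) i (l - m) j)
          (wave (a m j) (k j)) (x j)) (volume.restrict (openCube N)) := fun m _ =>
      integrable_mul_prod hfi fun j => continuous_iteratedDeriv' (hw m j (k j)) _
    rw [Finset.sum_congr rfl fun m _ => h1 m, ← integral_finsetSum _ hi, coeff,
      ← integral_const_mul]
    refine integral_congr_ae (Filter.Eventually.of_forall fun x => ?_)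
    have h2 : ∀ m, ∏ j, iteratedDeriv (Pi.single (M := fun _ => ℕ) i (l - m) j)
        (wave (a m j) (k j)) (x j) = iteratedDeriv (l - m) (wave (β m) (k i)) (x i) *
          ∏ j ∈ Finset.univ.erase i, wave α (k j) (x j) := by
      intro m
      rw [← Finset.mul_prod_erase _ _ (Finset.mem_univ i)]
      congr 1
      · simp [a]
      · refine Finset.prod_congr rfl fun j hj => ?_
        simp [a, Finset.ne_of_mem_erase hj]
    simp only [h2]
    rw [← Finset.mul_sum, ← Finset.sum_mul, ← hαβ, ← Finset.mul_prod_erase _ _ (Finset.mem_univ i)]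
    ring
  have hs : Summable fun k : Fin N → ℤ => ‖(-(Real.pi * Complex.I * k i)) ^ l * coeff f α k‖ ^ 2 := by
    refine (summable_sq_sum (Finset.range (l + 1)) fun m _ => ?_).congr fun k => by rw [key k]
    refine (summable_sq_wave (hg m) (a := a m) fun j s => (ha m j s).continuous).congr fun k => ?_
    rw [norm_mul, norm_pow, norm_neg, norm_one, one_pow, one_mul]
  refine Summable.of_nonneg_of_le (fun k => by positivity) (fun k => ?_) hs
  refine pow_le_pow_left₀ (norm_nonneg _) ?_ 2
  rw [norm_mul, norm_mul]
  refine mul_le_mul_of_nonneg_right ?_ (norm_nonneg _)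
  rw [norm_pow, norm_pow, norm_neg, norm_mul, norm_mul, Complex.norm_I, mul_one, Complex.norm_real,
    Real.norm_of_nonneg Real.pi_pos.le]
  exact pow_le_pow_left₀ (norm_nonneg _)
    (le_mul_of_one_le_left (norm_nonneg _) (by linarith [Real.pi_gt_three])) l

/-- The supremum norm of a frequency. -/
def freqNorm (k : Fin N → ℤ) : ℝ := ‖fun j => (k j : ℝ)‖

lemma freqNorm_nonneg (k : Fin N → ℤ) : 0 ≤ freqNorm k := norm_nonneg _

/-- The sup norm dominates every `|k j|`, so the term is at most the product over `j` of `(1 + |k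
j|) ^ (-(s / N))`, with `s / N > 1`. -/
lemma summable_one_add_freqNorm {s : ℝ} (hs : (N : ℝ) < s) :
    Summable fun k : Fin N → ℤ => (1 + freqNorm k) ^ (-s) := by
  have hs0 : 0 < s := (Nat.cast_nonneg N).trans_lt hs
  have h1 : ∀ _j : Fin N, Summable fun n : ℤ => ‖(((1 + |(n : ℝ)|) ^ (-(s / N)) : ℝ) : ℂ)‖ := by
    intro j
    have hN : (0 : ℝ) < N := by exact_mod_cast Nat.pos_of_ne_zero (fun h => by subst h; exact j.elim0)
    have hsN : 1 < s / N := by rwa [lt_div_iff₀ hN, one_mul]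
    have h2 := Real.summable_abs_int_rpow hsN
    refine Summable.of_norm_bounded_eventually (g := fun n : ℤ => |(n : ℝ)| ^ (-(s / N))) h2 ?_
    filter_upwards [(Set.finite_singleton (0 : ℤ)).compl_mem_cofinite] with n hn
    have hn0 : 0 < |(n : ℝ)| := abs_pos.2 (by simpa using hn)
    rw [norm_norm, Complex.norm_real, Real.norm_of_nonneg (by positivity)]
    exact Real.rpow_le_rpow_of_nonpos hn0 (by linarith) (by linarith)
  refine Summable.of_nonneg_of_le (fun k => Real.rpow_nonneg (by linarith [freqNorm_nonneg k]) _)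
    (fun k => ?_) (hasSum_prod_pi (fun _ n => (((1 + |(n : ℝ)|) ^ (-(s / N)) : ℝ) : ℂ)) h1).1
  rw [norm_prod]
  have hpos : 0 < 1 + freqNorm k := by linarith [freqNorm_nonneg k]
  rcases Nat.eq_zero_or_pos N with rfl | hN
  · simp only [Finset.univ_eq_empty, Finset.prod_empty]
    exact Real.rpow_le_one_of_one_le_of_nonpos (by linarith [freqNorm_nonneg k]) (by linarith)
  · have hN' : (0 : ℝ) < N := by exact_mod_cast hN
    calc (1 + freqNorm k) ^ (-s) = ∏ _j : Fin N, (1 + freqNorm k) ^ (-(s / N)) := by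
          rw [Finset.prod_const, Finset.card_univ, Fintype.card_fin, ← Real.rpow_mul_natCast hpos.le]
          congr 1; field_simp
      _ ≤ _ := by
          refine Finset.prod_le_prod (fun _ _ => Real.rpow_nonneg hpos.le _) fun j _ => ?_
          rw [Complex.norm_real, Real.norm_of_nonneg (by positivity)]
          refine Real.rpow_le_rpow_of_nonpos (by positivity) ?_
            (neg_nonpos.2 (by positivity))
          have : |(k j : ℝ)| ≤ freqNorm k := norm_le_pi_norm (fun j => (k j : ℝ)) j
          linarith

/-- The coefficients decay so fast that the Fourier series is a Barron function. -/
theorem summable_coeff_mul_sq {l : ℕ} (hl : (N : ℝ) / 2 + 2 < l) {c : (Fin N → ℤ) → ℂ}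
    (h0 : Summable fun k => ‖c k‖ ^ 2)
    (h1 : ∀ i, Summable fun k : Fin N → ℤ => ‖((k i : ℂ)) ^ l * c k‖ ^ 2) :
    Summable fun k => ‖c k‖ * (1 + freqNorm k) ^ 2 := by
  -- The hypothesis on `l` says exactly `2 (l - 2) > N`. Below, `‖c k‖ X^2` is split as `(‖c k‖ X^l)
  -- * X^(-(l - 2))` and bounded by the sum of the two squares.
  have hs : Summable fun k : Fin N → ℤ => (1 + freqNorm k) ^ (-(2 * ((l : ℝ) - 2))) :=
    summable_one_add_freqNorm (by linarith)
  have hA : Summable fun k : Fin N → ℤ =>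
      (2 ^ l) ^ 2 * (‖c k‖ ^ 2 + ∑ i, ‖((k i : ℂ)) ^ l * c k‖ ^ 2) :=
    (h0.add (summable_sum fun i _ => h1 i)).mul_left _
  refine Summable.of_nonneg_of_le (fun k => by positivity) (fun k => ?_) (hA.add hs)
  set X := 1 + freqNorm k with hX
  have hX1 : 1 ≤ X := by linarith [freqNorm_nonneg k]
  have hX0 : 0 < X := by linarith
  have e1 : ‖c k‖ * X ^ 2 = (‖c k‖ * X ^ l) * X ^ (-((l : ℝ) - 2)) := by
    rw [mul_assoc, ← Real.rpow_natCast X l, ← Real.rpow_add hX0, ← Real.rpow_natCast X 2]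
    congr 2; push_cast; ring
  have e2 : X ^ (-(2 * ((l : ℝ) - 2))) = (X ^ (-((l : ℝ) - 2))) ^ 2 := by
    rw [← Real.rpow_natCast, ← Real.rpow_mul hX0.le]; congr 1; push_cast; ring
  have e3 : (‖c k‖ * X ^ l) ^ 2 ≤
      (2 ^ l) ^ 2 * (‖c k‖ ^ 2 + ∑ i, ‖((k i : ℂ)) ^ l * c k‖ ^ 2) := by
    have hsum : 0 ≤ ∑ i, ‖((k i : ℂ)) ^ l * c k‖ ^ 2 := Finset.sum_nonneg fun i _ => by positivity
    rcases le_or_gt (freqNorm k) 1 with h | h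
    · have : X ^ l ≤ 2 ^ l := pow_le_pow_left₀ hX0.le (by linarith) l
      calc (‖c k‖ * X ^ l) ^ 2 ≤ (‖c k‖ * 2 ^ l) ^ 2 :=
            pow_le_pow_left₀ (by positivity) (mul_le_mul_of_nonneg_left this (norm_nonneg _)) 2
        _ = (2 ^ l) ^ 2 * ‖c k‖ ^ 2 := by ring
        _ ≤ _ := mul_le_mul_of_nonneg_left (by linarith) (by positivity)
    · obtain ⟨i, hi⟩ : ∃ i, freqNorm k = |(k i : ℝ)| := by
        have hne : Nonempty (Fin N) := by
          by_contra hne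
          rw [not_nonempty_iff] at hne
          have : freqNorm k = 0 := by
            simp only [freqNorm]; rw [Subsingleton.elim (fun j => (k j : ℝ)) 0, norm_zero]
          linarith
        obtain ⟨i, _, hi⟩ := Finset.exists_mem_eq_sup' Finset.univ_nonempty
          fun j => ‖(k j : ℝ)‖
        refine ⟨i, le_antisymm ?_ (norm_le_pi_norm (fun j => (k j : ℝ)) i)⟩
        refine (pi_norm_le_iff_of_nonneg (abs_nonneg _)).2 fun j => ?_
        exact (Finset.le_sup' (fun j => ‖(k j : ℝ)‖) (Finset.mem_univ j)).trans hi.le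
      have hle : X ^ l ≤ 2 ^ l * |(k i : ℝ)| ^ l := by
        rw [← mul_pow]; exact pow_le_pow_left₀ hX0.le (by rw [← hi]; linarith) l
      have hn : ‖((k i : ℂ)) ^ l * c k‖ = |(k i : ℝ)| ^ l * ‖c k‖ := by
        rw [norm_mul, norm_pow, Complex.norm_intCast]
      calc (‖c k‖ * X ^ l) ^ 2 ≤ (‖c k‖ * (2 ^ l * |(k i : ℝ)| ^ l)) ^ 2 :=
            pow_le_pow_left₀ (by positivity) (mul_le_mul_of_nonneg_left hle (norm_nonneg _)) 2
        _ = (2 ^ l) ^ 2 * ‖((k i : ℂ)) ^ l * c k‖ ^ 2 := by rw [hn]; ring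
        _ ≤ _ := by
            refine mul_le_mul_of_nonneg_left ?_ (by positivity)
            have := Finset.single_le_sum (f := fun i => ‖((k i : ℂ)) ^ l * c k‖ ^ 2)
              (fun i _ => by positivity) (Finset.mem_univ i)
            have h3 : 0 ≤ ‖c k‖ ^ 2 := by positivity
            linarith
  rw [e1, e2]
  nlinarith [sq_nonneg (‖c k‖ * X ^ l - X ^ (-((l : ℝ) - 2))), sq_nonneg (‖c k‖ * X ^ l),
    sq_nonneg (X ^ (-((l : ℝ) - 2)))]

/-! ### Reconstruction in one variable -/

open scoped FourierTransform in
/-- Poisson summation with period `2` for a smooth function supported in the unit interval. -/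
theorem poisson_period_two {φ : ℝ → ℂ} (hφ : ContDiff ℝ ∞ φ) (h0 : ∀ x ∉ Ioo (0 : ℝ) 1, φ x = 0) :
    (Summable fun n : ℤ => ‖∫ y in Ioo (0 : ℝ) 1, char n y * φ y‖) ∧
      ∀ x, ∑' n : ℤ, (∫ y in Ioo (0 : ℝ) 1, char n y * φ y) * char (-n) x =
        2 * ∑' m : ℤ, φ (x + 2 * m) := by
  -- Rescaling reduces period `2` to Poisson summation over the integers.
  have hs : ContDiff ℝ ∞ fun y => φ (2 * y) := hφ.comp (contDiff_const.mul contDiff_id)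
  have hc : HasCompactSupport fun y => φ (2 * y) :=
    HasCompactSupport.intro (isCompact_Icc (a := (0 : ℝ)) (b := 1)) fun x hx => h0 _ fun h =>
      hx ⟨by linarith [h.1], by linarith [h.2]⟩
  set F : SchwartzMap ℝ ℂ := hc.toSchwartzMap hs with hF
  have hFa : ∀ y, F y = φ (2 * y) := fun y => rfl
  have hd : ∀ n : ℤ, (𝓕 F) (n : ℝ) = 2⁻¹ * ∫ y in Ioo (0 : ℝ) 1, char (-n) y * φ y := by
    intro n
    rw [SchwartzMap.fourier_coe, Real.fourier_real_eq_integral_exp_smul]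
    have h1 : ∀ v : ℝ, Complex.exp (((-2 * Real.pi * v * n : ℝ) : ℂ) * Complex.I) • F v =
        (fun y => char (-n) y * φ y) (2 * v) := by
      intro v
      simp only [hFa, smul_eq_mul, char]
      congr 2
      push_cast; ring
    simp only [h1]
    rw [Measure.integral_comp_mul_left (fun y => char (-n) y * φ y) 2,
      setIntegral_eq_integral_of_forall_compl_eq_zero fun x hx => by rw [h0 x hx, mul_zero]]
    rw [abs_of_pos (by norm_num), Complex.real_smul]
    push_cast
    rfl
  have hsum : Summable fun n : ℤ => (𝓕 F) (n : ℝ) :=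
    summable_of_isBigO (Real.summable_abs_int_rpow one_lt_two)
      (((𝓕 F).isBigO_cocompact_rpow (-2)).comp_tendsto Int.tendsto_coe_cofinite)
  constructor
  · have h2 := (hsum.norm.mul_left 2)
    rw [← (Equiv.neg ℤ).summable_iff] at h2
    refine h2.congr fun n => ?_
    rw [Function.comp_apply, hd, norm_mul, Equiv.neg_apply, neg_neg]
    simp
  · intro x
    have hp := F.tsum_eq_tsum_fourier (x / 2)
    have h3 : ∀ n : ℤ, F (x / 2 + n) = φ (x + 2 * n) := by
      intro n; rw [hFa]; congr 1; ring
    have h4 : ∀ n : ℤ, fourier n ((x / 2 : ℝ) : UnitAddCircle) = char n x := by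
      intro n
      rw [fourier_coe_apply, char]
      congr 1
      push_cast; ring
    simp only [h3, h4, hd] at hp
    rw [hp, ← tsum_mul_left, ← (Equiv.neg ℤ).tsum_eq]
    refine tsum_congr fun n => ?_
    rw [Equiv.neg_apply, neg_neg]
    ring

/-- The series is the transposed extension applied to twice the periodisation `P` of `φ`. The
reflected points, where they carry weight, fall where `P` vanishes, so only the identity term
survives. -/
theorem tsum_mul_wave {l : ℕ} {α : Option (Fin l) → ℝ → ℂ}
    (hα : ∀ P : ℝ → ℂ, Function.Periodic P 2 → (∀ y ∈ Icc (-1 : ℝ) 0, P y = 0) →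
      ∀ x ∈ Ioo (0 : ℝ) 1, ∑ s, α s x * P (-(freq s * x)) = 2⁻¹ * P x)
    {φ : ℝ → ℂ} (hφ : ContDiff ℝ ∞ φ) (h0 : ∀ x ∉ Ioo (0 : ℝ) 1, φ x = 0) {x : ℝ}
    (hx : x ∈ Ioo (0 : ℝ) 1) :
    ∑' n : ℤ, (∫ y in Ioo (0 : ℝ) 1, char n y * φ y) * wave α n x = φ x := by
  obtain ⟨hsum, hP⟩ := poisson_period_two hφ h0
  set d : ℤ → ℂ := fun n => ∫ y in Ioo (0 : ℝ) 1, char n y * φ y with hd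
  set P : ℝ → ℂ := fun y => ∑' m : ℤ, φ (y + 2 * m) with hPdef
  have hper : Function.Periodic P 2 := by
    intro y
    simp only [hPdef]
    rw [← (Equiv.addRight (1 : ℤ)).tsum_eq fun m : ℤ => φ (y + 2 * m)]
    refine tsum_congr fun m => ?_
    congr 1
    simp only [Equiv.coe_addRight]
    push_cast; ring
  have hP0 : ∀ y ∈ Icc (-1 : ℝ) 0, P y = 0 := by
    intro y hy
    have h1 : ∀ m : ℤ, φ (y + 2 * m) = 0 := by
      intro m
      refine h0 _ fun h => ?_
      have h2 : (0 : ℝ) < m := by linarith [h.1, hy.2]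
      have h3 : (m : ℝ) < 1 := by linarith [h.2, hy.1]
      have h2' : 0 < m := by exact_mod_cast h2
      have h3' : m < 1 := by exact_mod_cast h3
      omega
    simp only [hPdef, h1, tsum_zero]
  have hPx : P x = φ x := by
    simp only [hPdef]
    rw [tsum_eq_single 0 fun m hm => h0 _ fun h => hm ?_]
    · simp
    · have h2 : (-1 : ℝ) < m := by linarith [h.1, hx.2]
      have h3 : (m : ℝ) < 1 := by linarith [h.2, hx.1]
      have h2' : -1 < m := by exact_mod_cast h2
      have h3' : m < 1 := by exact_mod_cast h3
      omega
  have hch : ∀ (s : Option (Fin l)) (n : ℤ), char (freq s * n) x = char (-n) (-(freq s * x)) := by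
    intro s n
    simp only [char]
    congr 1
    push_cast; ring
  have hsm : ∀ s ∈ (Finset.univ : Finset (Option (Fin l))),
      Summable fun n : ℤ => α s x * (d n * char (-n) (-(freq s * x))) := fun s _ => by
    refine Summable.mul_left _ (Summable.of_norm ?_)
    simpa [norm_char] using hsum
  calc ∑' n : ℤ, d n * wave α n x
      = ∑' n : ℤ, ∑ s, α s x * (d n * char (-n) (-(freq s * x))) := by
        refine tsum_congr fun n => ?_
        rw [wave, Finset.mul_sum]
        exact Finset.sum_congr rfl fun s _ => by rw [hch]; ring
    _ = ∑ s, α s x * (2 * P (-(freq s * x))) := by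
        rw [Summable.tsum_finsetSum hsm]
        exact Finset.sum_congr rfl fun s _ => by rw [tsum_mul_left, hP]
    _ = 2 * ∑ s, α s x * P (-(freq s * x)) := by
        rw [Finset.mul_sum]; exact Finset.sum_congr rfl fun s _ => by ring
    _ = φ x := by rw [hα P hper hP0 x hx, hPx]; ring

lemma exists_bound_wave {l : ℕ} {α : Option (Fin l) → ℝ → ℂ} (hα : ∀ s, Continuous (α s)) :
    ∃ C, 0 ≤ C ∧ ∀ n, ∀ x ∈ Ioo (0 : ℝ) 1, ‖wave α n x‖ ≤ C := by
  choose C hC0 hC using fun s => exists_bound_on_Icc (hα s)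
  refine ⟨∑ s, C s, Finset.sum_nonneg fun s _ => hC0 s, fun n x hx => ?_⟩
  refine (norm_sum_le _ _).trans (Finset.sum_le_sum fun s _ => ?_)
  rw [norm_mul, norm_char, mul_one]
  exact hC s x hx

/-! ### Reconstruction in several variables -/

lemma hasSum_integral_of_norm_le {α ι : Type*} [Countable ι] {_ : MeasurableSpace α} {μ : Measure α}
    {F : ι → α → ℂ} {b : ι → ℝ} {h : α → ℝ} (hh : Integrable h μ) (hb : Summable b)
    (hF : ∀ i, AEStronglyMeasurable (F i) μ) (hle : ∀ i, ∀ᵐ x ∂μ, ‖F i x‖ ≤ b i * h x) :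
    HasSum (fun i => ∫ x, F i x ∂μ) (∫ x, ∑' i, F i x ∂μ) := by
  have hi : ∀ i, Integrable (F i) μ := fun i => (hh.const_mul (b i)).mono' (hF i) (hle i)
  refine hasSum_integral_of_summable_integral_norm hi ?_
  refine Summable.of_nonneg_of_le (fun i => integral_nonneg fun x => norm_nonneg _) (fun i => ?_)
    (hb.mul_right (∫ x, h x ∂μ))
  rw [← integral_const_mul]
  exact integral_mono_ae (hi i).norm (hh.const_mul _) (hle i)

/-- The Fourier series with coefficients `c`. -/
def series (c : (Fin N → ℤ) → ℂ) (x : EuclideanSpace ℝ (Fin N)) : ℂ := ∑' k, c k * charN k x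

lemma continuous_series {c : (Fin N → ℤ) → ℂ} (hc : Summable fun k => ‖c k‖) :
    Continuous (series c) :=
  continuous_tsum (fun k => continuous_const.mul (continuous_charN k)) hc fun k x => by
    rw [norm_mul, norm_charN, mul_one]

lemma norm_series_le {c : (Fin N → ℤ) → ℂ} (hc : Summable fun k => ‖c k‖)
    (x : EuclideanSpace ℝ (Fin N)) : ‖series c x‖ ≤ ∑' k, ‖c k‖ := by
  have h : ∀ k, ‖c k * charN k x‖ = ‖c k‖ := fun k => by rw [norm_mul, norm_charN, mul_one]
  have := norm_tsum_le_tsum_norm (f := fun k => c k * charN k x) (by simpa only [h] using hc)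
  rw [series]
  simpa only [h] using this

theorem integral_series_mul_prod {c : (Fin N → ℤ) → ℂ} (hc : Summable fun k => ‖c k‖)
    {φ : Fin N → ℝ → ℂ} (hφ : ∀ j, Continuous (φ j)) :
    HasSum (fun k => c k * ∏ j, ∫ y in Ioo (0 : ℝ) 1, char (k j) y * φ j y)
      (∫ x in openCube N, series c x * ∏ j, φ j (x j)) := by
  have := isFiniteMeasure_openCube (N := N)
  obtain ⟨C, hC0, hC⟩ := exists_bound_prod hφ
  have h := hasSum_integral_of_norm_le (μ := volume.restrict (openCube N))
    (F := fun (k : Fin N → ℤ) x => c k * (charN k x * ∏ j, φ j (x j))) (b := fun k => ‖c k‖)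
    (h := fun _ => C) (integrable_const C) hc
    (fun k => (continuous_const.mul ((continuous_charN k).mul
      (continuous_prod_coord hφ))).aestronglyMeasurable)
    (fun k => by
      filter_upwards [ae_restrict_mem measurableSet_openCube] with x hx
      rw [norm_mul, norm_mul, norm_charN, one_mul]
      exact mul_le_mul_of_nonneg_left (hC x hx) (norm_nonneg _))
  have e1 : ∀ k : Fin N → ℤ, ∫ x in openCube N, c k * (charN k x * ∏ j, φ j (x j)) =
      c k * ∏ j, ∫ y in Ioo (0 : ℝ) 1, char (k j) y * φ j y := by
    intro k
    rw [integral_const_mul, ← integral_box_prod measurableSet_Ioo fun j y => char (k j) y * φ j y]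
    simp only [charN, ← Finset.prod_mul_distrib, openCube_eq_box]
  have e2 : ∀ x, ∑' k : Fin N → ℤ, c k * (charN k x * ∏ j, φ j (x j)) =
      series c x * ∏ j, φ j (x j) := by
    intro x
    rw [series, ← tsum_mul_right]
    exact tsum_congr fun k => by ring
  simpa only [e1, e2] using h

/-- Both sides equal `∑ coeff f α k * ∏ d j (k j)`, with `d j n` the integral of `char n * φ j`: the
right by integrating the series termwise, the left by expanding each `φ j` in waves. -/
theorem integral_mul_prod_eq_series {l : ℕ} {f : EuclideanSpace ℝ (Fin N) → ℝ}
    (hf : IntegrableOn f (openCube N)) {α : Option (Fin l) → ℝ → ℂ} (hαs : ∀ s, Continuous (α s))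
    (hα : ∀ P : ℝ → ℂ, Function.Periodic P 2 → (∀ y ∈ Icc (-1 : ℝ) 0, P y = 0) →
      ∀ x ∈ Ioo (0 : ℝ) 1, ∑ s, α s x * P (-(freq s * x)) = 2⁻¹ * P x)
    (hc : Summable fun k => ‖coeff f α k‖)
    {φ : Fin N → ℝ → ℂ} (hφ : ∀ j, ContDiff ℝ ∞ (φ j)) (h0 : ∀ j, ∀ x ∉ Ioo (0 : ℝ) 1, φ j x = 0) :
    ∫ x in openCube N, (f x : ℂ) * ∏ j, φ j (x j) =
      ∫ x in openCube N, series (coeff f α) x * ∏ j, φ j (x j) := by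
  have h1 := integral_series_mul_prod hc fun j => (hφ j).continuous
  obtain ⟨d, hd⟩ : ∃ d : Fin N → ℤ → ℂ, d = fun j n => ∫ y in Ioo (0 : ℝ) 1, char n y * φ j y :=
    ⟨_, rfl⟩
  have hdj : ∀ j n, ∫ y in Ioo (0 : ℝ) 1, char n y * φ j y = d j n := fun j n => by rw [hd]
  have hds : ∀ j, Summable fun n => ‖d j n‖ := fun j => by
    simpa only [hdj] using (poisson_period_two (hφ j) (h0 j)).1
  simp only [hdj] at h1
  obtain ⟨C, hC0, hC⟩ := exists_bound_wave hαs
  have hwc : ∀ n, Continuous (wave α n) := fun n =>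
    continuous_finsetSum _ fun s _ => (hαs s).mul (continuous_char _)
  have h2 := hasSum_integral_of_norm_le (μ := volume.restrict (openCube N))
    (F := fun (k : Fin N → ℤ) x => (f x : ℂ) * ∏ j, (d j (k j) * wave α (k j) (x j)))
    (b := fun k => ‖∏ j, d j (k j)‖) (h := fun x => ‖f x‖ * C ^ N)
    (hf.norm.mul_const _) (hasSum_prod_pi d hds).1
    (fun k => (integrable_mul_prod (a := fun j y => d j (k j) * wave α (k j) y) hf
      fun j => continuous_const.mul (hwc _)).aestronglyMeasurable)
    (fun k => by
      filter_upwards [ae_restrict_mem measurableSet_openCube] with x hx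
      rw [Finset.prod_mul_distrib, norm_mul, norm_mul, Complex.norm_real, norm_prod (f := fun j => wave α (k j) (x j))]
      have : ∏ j, ‖wave α (k j) (x j)‖ ≤ C ^ N := by
        refine (Finset.prod_le_prod (fun _ _ => norm_nonneg _) fun j _ => hC (k j) _ (hx j)).trans ?_
        simp
      calc ‖f x‖ * (‖∏ j, d j (k j)‖ * ∏ j, ‖wave α (k j) (x j)‖)
          = (‖f x‖ * ‖∏ j, d j (k j)‖) * ∏ j, ‖wave α (k j) (x j)‖ := by ring
        _ ≤ (‖f x‖ * ‖∏ j, d j (k j)‖) * C ^ N := mul_le_mul_of_nonneg_left this (by positivity)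
        _ = _ := by ring)
  have e1 : ∀ k : Fin N → ℤ, ∫ x in openCube N, (f x : ℂ) *
      ∏ j, (d j (k j) * wave α (k j) (x j)) = coeff f α k * ∏ j, d j (k j) := by
    intro k
    rw [coeff, ← integral_mul_const]
    refine integral_congr_ae (Filter.Eventually.of_forall fun x => ?_)
    simp only [Finset.prod_mul_distrib]
    ring
  have e2 : ∫ x in openCube N, ∑' k : Fin N → ℤ, (f x : ℂ) *
      ∏ j, (d j (k j) * wave α (k j) (x j)) = ∫ x in openCube N, (f x : ℂ) * ∏ j, φ j (x j) := by
    refine setIntegral_congr_fun measurableSet_openCube fun x hx => ?_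
    have h3 := (hasSum_prod_pi (fun j n => d j n * wave α n (x j)) fun j => by
      refine Summable.of_nonneg_of_le (fun n => norm_nonneg _) (fun n => ?_) ((hds j).mul_right C)
      rw [norm_mul]
      exact mul_le_mul_of_nonneg_left (hC n _ (hx j)) (norm_nonneg _)).2
    beta_reduce
    rw [tsum_mul_left, h3.tsum_eq]
    congr 1
    refine Finset.prod_congr rfl fun j _ => ?_
    rw [hd]
    exact tsum_mul_wave hα (hφ j) (h0 j) (hx j)
  simp only [e1] at h2
  rw [e2] at h2
  exact h2.unique h1

/-! ### Uniqueness -/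

/-- A real integrable function whose Fourier transform vanishes is zero. -/
theorem ae_eq_zero_of_forall_integral_mul_exp {E : Type*} [NormedAddCommGroup E]
    [InnerProductSpace ℝ E] [MeasurableSpace E] [BorelSpace E] [SecondCountableTopology E]
    [CompleteSpace E] {ν : Measure E} [SigmaFinite ν] {R : E → ℝ} (hR : Integrable R ν)
    (h : ∀ t : E, ∫ x, (R x : ℂ) * Complex.exp ((inner ℝ x t : ℝ) * Complex.I) ∂ν = 0) :
    R =ᵐ[ν] 0 := by
  obtain ⟨R', hR'm, hRR'⟩ := hR.aestronglyMeasurable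
  have hR' : Integrable R' ν := hR.congr hRR'
  have hm := hR'm.measurable
  have hp : ∫⁻ x, ENNReal.ofReal (R' x) ∂ν ≠ ⊤ := (hR'.lintegral_lt_top).ne
  have hn : ∫⁻ x, ENNReal.ofReal (-R' x) ∂ν ≠ ⊤ := (hR'.neg.lintegral_lt_top).ne
  have := isFiniteMeasure_withDensity hp
  have := isFiniteMeasure_withDensity hn
  have hexp : ∀ t : E, Continuous fun x => Complex.exp ((inner ℝ x t : ℝ) * Complex.I) := fun t => by
    fun_prop
  have hint : ∀ {q : E → ℝ}, Integrable q ν → ∀ t : E, Integrable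
      (fun x => (q x : ℂ) * Complex.exp ((inner ℝ x t : ℝ) * Complex.I)) ν := fun hq t =>
    integrable_ofReal_mul hq (hexp t).aestronglyMeasurable (C := 1)
      (Filter.Eventually.of_forall fun x => by rw [Complex.norm_exp_ofReal_mul_I])
  have hchar : ∀ {q : E → ℝ}, Measurable q → ∀ t : E,
      charFun (ν.withDensity fun x => ENNReal.ofReal (q x)) t =
        ∫ x, ((max (q x) 0 : ℝ) : ℂ) * Complex.exp ((inner ℝ x t : ℝ) * Complex.I) ∂ν := by
    intro q hq t
    rw [charFun_apply, integral_withDensity_eq_integral_toReal_smul hq.ennreal_ofReal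
      (Filter.Eventually.of_forall fun x => ENNReal.ofReal_lt_top)]
    refine integral_congr_ae (Filter.Eventually.of_forall fun x => ?_)
    beta_reduce
    rw [ENNReal.toReal_ofReal', Complex.real_smul]
  -- The positive and negative parts of `R'` are densities of finite measures with the same
  -- characteristic function.
  have heq : (ν.withDensity fun x => ENNReal.ofReal (R' x)) =
      ν.withDensity fun x => ENNReal.ofReal (-R' x) := by
    refine Measure.ext_of_charFun (funext fun t => ?_)
    rw [hchar hm, hchar (q := fun x => -R' x) hm.neg, ← sub_eq_zero, ← integral_sub (hint hR'.pos_part t)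
      (hint hR'.neg_part t), ← h t]
    refine integral_congr_ae ?_
    filter_upwards [hRR'] with x hx
    rw [← sub_mul, hx, ← Complex.ofReal_sub]
    congr 2
    rcases le_total (R' x) 0 with h' | h'
    · rw [max_eq_right h', max_eq_left (by simpa using h')]; ring
    · rw [max_eq_left h', max_eq_right (by simpa using h')]; ring
  have hae := (withDensity_eq_iff hm.ennreal_ofReal.aemeasurable
    hm.neg.ennreal_ofReal.aemeasurable hp).1 heq
  filter_upwards [hae, hRR'] with x hx hx'
  rw [hx', Pi.zero_apply]
  rcases le_total (R' x) 0 with h' | h'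
  · rw [ENNReal.ofReal_of_nonpos h', eq_comm, Pi.neg_apply, ENNReal.ofReal_eq_zero] at hx
    linarith
  · rw [Pi.neg_apply, ENNReal.ofReal_of_nonpos (p := -R' x) (by linarith),
      ENNReal.ofReal_eq_zero] at hx
    linarith

/-- A smooth function that is positive on `(0,1)` and zero elsewhere. -/
def bump (x : ℝ) : ℝ := expNegInvGlue x * expNegInvGlue (1 - x)

lemma contDiff_bump : ContDiff ℝ ∞ bump :=
  expNegInvGlue.contDiff.mul (expNegInvGlue.contDiff.comp (contDiff_const.sub contDiff_id))

lemma bump_pos {x : ℝ} (hx : x ∈ Ioo (0 : ℝ) 1) : 0 < bump x :=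
  mul_pos (expNegInvGlue.pos_of_pos hx.1) (expNegInvGlue.pos_of_pos (by linarith [hx.2]))

lemma bump_eq_zero {x : ℝ} (hx : x ∉ Ioo (0 : ℝ) 1) : bump x = 0 := by
  rw [mem_Ioo, not_and_or, not_lt, not_lt] at hx
  rcases hx with h | h
  · rw [bump, expNegInvGlue.zero_of_nonpos h, zero_mul]
  · rw [bump, expNegInvGlue.zero_of_nonpos (x := 1 - x) (by linarith), mul_zero]

/-- Products of smooth functions supported in the unit interval separate functions on the cube. -/
theorem ae_eq_re_of_forall_integral_mul_prod {f : EuclideanSpace ℝ (Fin N) → ℝ}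
    {G : EuclideanSpace ℝ (Fin N) → ℂ} (hf : IntegrableOn f (openCube N))
    (hG : IntegrableOn G (openCube N))
    (h : ∀ φ : Fin N → ℝ → ℂ, (∀ j, ContDiff ℝ ∞ (φ j)) → (∀ j, ∀ x ∉ Ioo (0 : ℝ) 1, φ j x = 0) →
      ∫ x in openCube N, (f x : ℂ) * ∏ j, φ j (x j) = ∫ x in openCube N, G x * ∏ j, φ j (x j)) :
    f =ᵐ[volume.restrict (openCube N)] fun x => (G x).re := by
  have hO := measurableSet_openCube (N := N)
  -- Multiplied by `B`, a plane wave becomes an admissible product of test functions; since `B > 0`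
  -- on the open cube, nothing is lost.
  obtain ⟨B, hB⟩ : ∃ B : EuclideanSpace ℝ (Fin N) → ℝ, B = fun x => ∏ j, bump (x j) := ⟨_, rfl⟩
  have hBc : Continuous B := by
    rw [hB]
    exact continuous_finsetProd _ fun j _ => contDiff_bump.continuous.comp (by fun_prop)
  have hBpos : ∀ x ∈ openCube N, 0 < B x := fun x hx => by
    rw [hB]; exact Finset.prod_pos fun j _ => bump_pos (hx j)
  obtain ⟨C, hC⟩ := (isCompact_box (N := N) isCompact_Icc).exists_bound_of_continuousOn
    (hBc.continuousOn (s := box N (Icc 0 1)))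
  have hCae : ∀ᵐ x ∂(volume.restrict (openCube N)), ‖B x‖ ≤ C := by
    filter_upwards [ae_restrict_mem hO] with x hx using hC x fun j => Ioo_subset_Icc_self (hx j)
  have hexp : ∀ t : EuclideanSpace ℝ (Fin N),
      Continuous fun x => Complex.exp ((inner ℝ x t : ℝ) * Complex.I) := fun t => by fun_prop
  have hpw : ∀ t x : EuclideanSpace ℝ (Fin N),
      ∏ j, ((bump (x j) : ℂ) * Complex.exp ((x j * t j : ℝ) * Complex.I)) =
        B x * Complex.exp ((inner ℝ x t : ℝ) * Complex.I) := by
    intro t x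
    rw [Finset.prod_mul_distrib, ← Complex.exp_sum, ← Finset.sum_mul, hB]
    push_cast
    congr 3
    rw [PiLp.inner_apply]
    push_cast
    exact Finset.sum_congr rfl fun j _ => by simp [mul_comm]
  have hFB : ∀ {H : EuclideanSpace ℝ (Fin N) → ℂ}, IntegrableOn H (openCube N) → ∀ t,
      Integrable (fun x => H x * (B x * Complex.exp ((inner ℝ x t : ℝ) * Complex.I)))
        (volume.restrict (openCube N)) := by
    intro H hH t
    refine (hH.bdd_mul (c := C) ((Complex.continuous_ofReal.comp hBc).mul
      (hexp t)).aestronglyMeasurable ?_).congr (Filter.Eventually.of_forall fun x => mul_comm _ _)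
    filter_upwards [hCae] with x hx
    rw [Pi.mul_apply, norm_mul, Complex.norm_exp_ofReal_mul_I, mul_one, Function.comp_apply, Complex.norm_real]
    exact hx
  have hfC : IntegrableOn (fun x => (f x : ℂ)) (openCube N) := hf.ofReal
  have hH0 : ∀ t, ∫ x in openCube N, ((f x : ℂ) - G x) *
      (B x * Complex.exp ((inner ℝ x t : ℝ) * Complex.I)) = 0 := by
    intro t
    have h1 := h (fun j y => (bump y : ℂ) * Complex.exp ((y * t j : ℝ) * Complex.I))
      (fun j => (Complex.ofRealCLM.contDiff.comp contDiff_bump).mul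
        (Complex.contDiff_exp.comp ((Complex.ofRealCLM.contDiff.comp
          (contDiff_id.mul contDiff_const)).mul contDiff_const)))
      (fun j y hy => by rw [bump_eq_zero hy]; simp)
    simp only [hpw] at h1
    simp only [sub_mul]
    rw [integral_sub (hFB hfC t) (hFB hG t), h1, sub_self]
  have hRint : Integrable (fun x => (f x - (G x).re) * B x) (volume.restrict (openCube N)) :=
    ((hf.sub hG.re).bdd_mul hBc.aestronglyMeasurable hCae).congr
      (Filter.Eventually.of_forall fun x => mul_comm _ _)
  have hR := ae_eq_zero_of_forall_integral_mul_exp hRint fun t => by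
    -- `G` is complex. Conjugating the identity at `-t` gives the transform of the conjugate at `t`;
    -- averaging the two isolates the real part.
    have hconj := congrArg (starRingEnd ℂ) (hH0 (-t))
    rw [map_zero, ← integral_conj] at hconj
    have hi1 := hFB (hfC.sub hG) t
    have hi2 := hFB (H := fun x => (starRingEnd ℂ) ((f x : ℂ) - G x))
      (Complex.conjLIE.toContinuousLinearEquiv.toContinuousLinearMap.integrable_comp
        (hfC.sub hG)) t
    have e : ∀ x, (starRingEnd ℂ) (((f x : ℂ) - G x) *
        (B x * Complex.exp ((inner ℝ x (-t) : ℝ) * Complex.I))) =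
        (starRingEnd ℂ) ((f x : ℂ) - G x) *
          (B x * Complex.exp ((inner ℝ x t : ℝ) * Complex.I)) := by
      intro x
      simp only [map_mul, ← Complex.exp_conj, Complex.conj_ofReal, Complex.conj_I, inner_neg_right]
      congr 3
      push_cast; ring
    simp only [e] at hconj
    have h3 : ∀ x, (((f x - (G x).re) * B x : ℝ) : ℂ) *
        Complex.exp ((inner ℝ x t : ℝ) * Complex.I) = 2⁻¹ * (((f x : ℂ) - G x) *
          (B x * Complex.exp ((inner ℝ x t : ℝ) * Complex.I)) +
        (starRingEnd ℂ) ((f x : ℂ) - G x) *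
          (B x * Complex.exp ((inner ℝ x t : ℝ) * Complex.I))) := by
      intro x
      rw [← add_mul, Complex.add_conj]
      push_cast
      simp only [Complex.sub_re, Complex.ofReal_re]
      push_cast
      ring
    simp only [h3]
    rw [integral_const_mul]
    have h4 := integral_add hi1 hi2
    simp only [Pi.sub_apply] at h4
    rw [h4, hH0 t, hconj]
    simp
  filter_upwards [hR, ae_restrict_mem hO] with x hx hxO
  have := (mul_eq_zero.1 hx).resolve_right (hBpos x hxO).ne'
  linarith

/-- The frequency vector `π k`. -/
def freqVec (k : Fin N → ℤ) : EuclideanSpace ℝ (Fin N) := WithLp.toLp 2 fun j => Real.pi * k j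

lemma charN_eq_exp (k : Fin N → ℤ) (x : EuclideanSpace ℝ (Fin N)) :
    charN k x = Complex.exp ((inner ℝ (freqVec k) x : ℝ) * Complex.I) := by
  simp only [charN, char_eq_exp]
  rw [← Complex.exp_sum, ← Finset.sum_mul, ← Complex.ofReal_sum, PiLp.inner_apply]
  congr 3
  exact Finset.sum_congr rfl fun j _ => by simp [freqVec, mul_comm]

lemma re_mul_charN (c : ℂ) (k : Fin N → ℤ) (x : EuclideanSpace ℝ (Fin N)) :
    (c * charN k x).re = ‖c‖ * Real.cos (inner ℝ (freqVec k) x + c.arg) := by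
  rw [charN_eq_exp]
  conv_lhs => rw [← Complex.norm_mul_exp_arg_mul_I c]
  rw [mul_assoc, ← Complex.exp_add, ← add_mul, ← Complex.ofReal_add, Complex.re_ofReal_mul,
    Complex.exp_ofReal_mul_I_re, add_comm]

lemma norm_freqVec_le (k : Fin N → ℤ) : ‖freqVec k‖ ≤ Real.pi * √N * freqNorm k := by
  have hp := Real.pi_pos.le
  have h0 := freqNorm_nonneg k
  rw [EuclideanSpace.norm_eq, show Real.pi * √N * freqNorm k = √(N * (Real.pi * freqNorm k) ^ 2) by
    rw [Real.sqrt_mul (Nat.cast_nonneg N), Real.sqrt_sq (by positivity)]; ring]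
  refine Real.sqrt_le_sqrt ?_
  calc ∑ j, ‖freqVec k j‖ ^ 2 ≤ ∑ _j : Fin N, (Real.pi * freqNorm k) ^ 2 := by
        refine Finset.sum_le_sum fun j _ => pow_le_pow_left₀ (norm_nonneg _) ?_ 2
        have : ‖(k j : ℝ)‖ ≤ freqNorm k := norm_le_pi_norm (fun j => (k j : ℝ)) j
        simp only [freqVec]
        rw [norm_mul, Real.norm_of_nonneg hp]
        exact mul_le_mul_of_nonneg_left this hp
    _ = N * (Real.pi * freqNorm k) ^ 2 := by simp

/-- A Fourier series with coefficients summable against `(1 + |k|)^2` is a Barron function. -/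
theorem memBarron_re_series {c : (Fin N → ℤ) → ℂ}
    (hc : Summable fun k => ‖c k‖ * (1 + freqNorm k) ^ 2) :
    MemBarron (cube N) fun x => (series c x).re := by
  have hc0 : Summable fun k => ‖c k‖ := Summable.of_nonneg_of_le (fun k => norm_nonneg _)
    (fun k => le_mul_of_one_le_right (norm_nonneg _)
      (one_le_pow₀ (by linarith [freqNorm_nonneg k]))) hc
  have hbound := fun k => hasBarronBound_cos ‖c k‖ (c k).arg (freqVec k)
  have hsum : Summable fun k => |‖c k‖| * (3 * (1 + √N) ^ 2 * (1 + ‖freqVec k‖) ^ 2) := by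
    refine Summable.of_nonneg_of_le (fun k => by positivity) (fun k => ?_)
      (hc.mul_left (3 * (1 + √N) ^ 2 * (1 + Real.pi * √N) ^ 2))
    have hp := Real.pi_pos.le
    have h0 := freqNorm_nonneg k
    have h1 : 1 + ‖freqVec k‖ ≤ (1 + Real.pi * √N) * (1 + freqNorm k) := by
      have : 0 ≤ Real.pi * √N := by positivity
      nlinarith [norm_freqVec_le k]
    have h2 := pow_le_pow_left₀ (by positivity) h1 2
    rw [abs_norm]
    calc ‖c k‖ * (3 * (1 + √N) ^ 2 * (1 + ‖freqVec k‖) ^ 2)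
        = ‖c k‖ * (3 * (1 + √N) ^ 2) * (1 + ‖freqVec k‖) ^ 2 := by ring
      _ ≤ ‖c k‖ * (3 * (1 + √N) ^ 2) * ((1 + Real.pi * √N) * (1 + freqNorm k)) ^ 2 :=
          mul_le_mul_of_nonneg_left h2 (by positivity)
      _ = _ := by ring
  refine (HasBarronBound.tsum hbound hsum.tsum_ofReal_lt_top fun x _ => ?_).memBarron
    hsum.tsum_ofReal_lt_top
  have hs : Summable fun k => c k * charN k x := Summable.of_norm <| by
    simpa only [norm_mul, norm_charN, mul_one] using hc0
  simp only [series, ← re_mul_charN]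
  exact Complex.re_tsum hs

end SobolevBarron

end

/-- Elements of `H^l` are classes of functions modulo null sets, whereas a Barron function has
values at all points of the cube. So the conclusion is about the representative of `f` that is
continuous on the closed cube; it is unique there. -/
theorem mainTheorem8 (N l : ℕ) (hl : (N : ℝ) / 2 + 2 < (l : ℝ))
    (f : EuclideanSpace ℝ (Fin N) → ℝ)
    (hf : SobolevBarron.MemSobolev l (SobolevBarron.openCube N) f) :
    ∃ g : EuclideanSpace ℝ (Fin N) → ℝ,
      ContinuousOn g (SobolevBarron.cube N) ∧
      f =ᵐ[volume.restrict (SobolevBarron.cube N)] g ∧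
      SobolevBarron.MemBarron (SobolevBarron.cube N) g := by
  open SobolevBarron in
  obtain ⟨α, β, hα, hβ, hαβ, hvan, hrec⟩ := exists_reflection l
  have hsq := summable_coeff_mul_sq hl (summable_sq_coeff hf.1 hα)
    (summable_sq_pow_mul_coeff hf hα hβ hαβ hvan)
  have hc : Summable fun k => ‖coeff f α k‖ := Summable.of_nonneg_of_le (fun k => norm_nonneg _)
    (fun k => le_mul_of_one_le_right (norm_nonneg _)
      (one_le_pow₀ (by linarith [freqNorm_nonneg k]))) hsq
  have := isFiniteMeasure_openCube (N := N)
  have hfi : IntegrableOn f (openCube N) := hf.1.integrable one_le_two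
  have hcont := continuous_series hc
  have hGi : IntegrableOn (series (coeff f α)) (openCube N) :=
    Integrable.of_bound hcont.aestronglyMeasurable _
      (Filter.Eventually.of_forall (norm_series_le hc))
  refine ⟨fun x => (series (coeff f α) x).re,
    (Complex.continuous_re.comp hcont).continuousOn, ?_, memBarron_re_series hsq⟩
  rw [← Measure.restrict_congr_set openCube_ae_eq_cube]
  exact ae_eq_re_of_forall_integral_mul_prod hfi hGi fun φ hφ h0 =>
    integral_mul_prod_eq_series hfi (fun s => (hα s).continuous) hrec hc hφ h0
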